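/- Let $(\Omega,\Sigma,\mu)$ be a complete finite measure space, let $L^0=L^0(\Omega)$ be the algebra of classes of complex measurable functions, and let $(\mathcal H,L)$ be a measurable bundle of complex Hilbert spaces over $\Omega$: each $\mathcal H(\omega)$ is a Hilbert space and $L$ is a set of almost everywhere defined sections, closed under linear combinations, such that $\omega\mapsto\|c(\omega)\|$ is measurable for all $c\in L$ and $\{c(\omega): c\in L,\ \omega\in\operatorname{dom} c\}$ is dense in $\mathcal H(\omega)$ for every $\omega\in\Omega$. A section is measurable if it is the a.e. limit of a sequence of step-sections $\sum_{i=1}^m\chi_{A_i}c_i$ ($A_i\in\Sigma$, $c_i\in L$). Let $L^0(\Omega,\mathcal H)$ be the $L^0$-module of classes $\hat u$ of measurable sections $u$ modulo a.e. equality, with the $L^0$-valued inner product $\langle\hat u,\hat v\rangle=\widehat{(u(\omega),v(\omega))}$ and the $L^0$-valued norm $\|\hat u\|=\widehat{\|u(\omega)\|}$. Let $T:L^0(\Omega,\mathcal H)\to L^0(\Omega,\mathcal H)$ be a contraction, that is, an $L^0$-linear operator that maps norm-order-bounded sets to norm-order-bounded sets and satisfies $\sup\{\|T\hat u\|:\|\hat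 u\|\le\mathbf 1\}\le\mathbf 1$. Put $A_n(T,\hat u)=\frac1n\sum_{k=0}^{n-1}T^k\hat u$. Then there is a projection $\hat P$ in $L^0(\Omega,\mathcal H)$, that is, an $L^0$-linear operator mapping bounded sets to bounded sets with $\hat P^2=\hat P$ and $\langle\hat P\hat u,\hat v\rangle=\langle\hat u,\hat P\hat v\rangle$ for all $\hat u,\hat v$, such that, for every $\hat u\in L^0(\Omega,\mathcal H)$, $A_n(T,\hat u)\to\hat P\hat u$ as $n\to\infty$ in the $L^0$-valued norm: $\|A_n(T,\hat u)-\hat P\hat u\|\to0$ in order in $L^0$ (that is, $(bo)$-convergence) and almost everywhere. Moreover, call a family of bounded linear operators $S_\omega:\mathcal H(\omega)\to\mathcal H(\omega)$, $\omega\in\Omega$, a measurable bundle of operators if $\omega\mapsto S_\omega x(\omega)$ is a measurable section for every measurable section $x$; it defines an operator $\hat S\hat x=\widehat{S_\omega x(\omega)}$ on $L^0(\Omega,\mathcal H)$. (a) If $T=\hat S$ for a measurable bundle $(S_\omega)$ of contractions, then $\hat P\hat u=\widehat{P(\omega)u(\omega)}$ for a measurable bundle of orthogonal projections $P(\omega)$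 with $\frac1n\sum_{k=0}^{n-1}S_\omega^kx\to P(\omega)x$ for all $\omega\in\Omega$ and $x\in\mathcal H(\omega)$. (b) If $(\mathcal H,L)$ admits a vector valued lifting, then there is a measurable bundle $(S_\omega)$ of contractions with $T=\hat S$. Here a lifting is a positive unital algebra homomorphism $p$ from $L^\infty(\Omega)$ to the bounded measurable functions on $\Omega$ with $p(f)\in f$ for all $f$, and a vector valued lifting associated with $p$ is an additive map $l$ from $L^\infty(\Omega,\mathcal H)=\{\hat u\in L^0(\Omega,\mathcal H):\|\hat u\|\in L^\infty(\Omega)\}$ to the everywhere defined measurable sections with $l(\hat u)\in\hat u$, $\|l(\hat u)(\omega)\|=p(\|\hat u\|)(\omega)$ and $l(\lambda\hat u)=p(\lambda)l(\hat u)$ for all $\hat u\in L^\infty(\Omega,\mathcal H)$, $\lambda\in L^\infty(\Omega)$ and $\omega\in\Omega$, such that $\{l(\hat u)(\omega):\hat u\in L^\infty(\Omega,\mathcal H)\}$ is dense in $\mathcal H(\omega)$ for every $\omega\in\Omega$. -/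

import Mathlib

open MeasureTheory Filter Topology

noncomputable section

namespace HilbertKaplansky

universe u v

/-- A section of the family `H`: a function defined almost everywhere on `Ω` with
values `u ω ∈ H ω`. -/
structure PartialSection {Ω : Type u} [MeasurableSpace Ω] (μ : Measure Ω) (H : Ω → Type v) where
  dom : Set Ω
  val : ∀ ω : dom, H ω
  ae_dom : ∀ᵐ ω ∂μ, ω ∈ dom

/-- Extension of an almost everywhere defined section by zero. -/
def PartialSection.ext {Ω : Type u} [MeasurableSpace Ω] {μ : Measure Ω} {H : Ω → Type v}
    [∀ ω, Zero (H ω)] (c : PartialSection μ H) (ω : Ω) : H ω :=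
  open Classical in if h : ω ∈ c.dom then c.val ⟨ω, h⟩ else 0

/-- The section `a c + b d`, defined on `dom c ∩ dom d`. -/
def PartialSection.lin {Ω : Type u} [MeasurableSpace Ω] {μ : Measure Ω} {H : Ω → Type v}
    [∀ ω, AddCommGroup (H ω)] [∀ ω, Module ℂ (H ω)]
    (a : ℂ) (c : PartialSection μ H) (b : ℂ) (d : PartialSection μ H) : PartialSection μ H where
  dom := c.dom ∩ d.dom
  val := fun ω => a • c.val ⟨ω, ω.2.1⟩ + b • d.val ⟨ω, ω.2.2⟩
  ae_dom := by filter_upwards [c.ae_dom, d.ae_dom] with ω h1 h2 using ⟨h1, h2⟩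

/-- A measurable bundle of Hilbert spaces over `(Ω, μ)`. -/
structure MeasurableBundle {Ω : Type u} [MeasurableSpace Ω] (μ : Measure Ω) (H : Ω → Type v)
    [∀ ω, NormedAddCommGroup (H ω)] [∀ ω, InnerProductSpace ℂ (H ω)]
    [∀ ω, CompleteSpace (H ω)] where
  L : Set (PartialSection μ H)
  lin_mem : ∀ (a b : ℂ), ∀ c ∈ L, ∀ d ∈ L, PartialSection.lin a c b d ∈ L
  measurable_norm : ∀ c ∈ L, Measurable (fun ω : c.dom => ‖c.val ω‖)
  dense : ∀ ω : Ω, Dense {x : H ω | ∃ c ∈ L, ∃ h : ω ∈ c.dom, x = c.val ⟨ω, h⟩}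

section Ring

variable {Ω : Type u} [MeasurableSpace Ω] {μ : Measure Ω}

/-- `L⁰(Ω)`, with the pointwise operations, is a commutative ring. -/
instance : CommRing (Ω →ₘ[μ] ℂ) where
  __ := (inferInstance : AddCommGroup (Ω →ₘ[μ] ℂ))
  __ := (inferInstance : CommMonoid (Ω →ₘ[μ] ℂ))
  left_distrib f g h := by
    refine AEEqFun.ext ?_
    filter_upwards [AEEqFun.coeFn_mul f (g + h), AEEqFun.coeFn_add g h,
      AEEqFun.coeFn_add (f * g) (f * h), AEEqFun.coeFn_mul f g, AEEqFun.coeFn_mul f h]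
      with ω h1 h2 h3 h4 h5
    simp only [h1, h2, h3, h4, h5, Pi.mul_apply, Pi.add_apply, mul_add]
  right_distrib f g h := by
    refine AEEqFun.ext ?_
    filter_upwards [AEEqFun.coeFn_mul (f + g) h, AEEqFun.coeFn_add f g,
      AEEqFun.coeFn_add (f * h) (g * h), AEEqFun.coeFn_mul f h, AEEqFun.coeFn_mul g h]
      with ω h1 h2 h3 h4 h5
    simp only [h1, h2, h3, h4, h5, Pi.mul_apply, Pi.add_apply, add_mul]
  zero_mul f := by
    refine AEEqFun.ext ?_
    filter_upwards [AEEqFun.coeFn_mul 0 f, AEEqFun.coeFn_zero (α := Ω) (μ := μ) (β := ℂ)]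
      with ω h1 h2
    simp only [h1, h2, Pi.mul_apply, Pi.zero_apply, zero_mul]
  mul_zero f := by
    refine AEEqFun.ext ?_
    filter_upwards [AEEqFun.coeFn_mul f 0, AEEqFun.coeFn_zero (α := Ω) (μ := μ) (β := ℂ)]
      with ω h1 h2
    simp only [h1, h2, Pi.mul_apply, Pi.zero_apply, mul_zero]

instance : Algebra ℂ (Ω →ₘ[μ] ℂ) :=
  Algebra.ofModule
    (fun a f g => by
      refine AEEqFun.ext ?_
      filter_upwards [AEEqFun.coeFn_mul (a • f) g, AEEqFun.coeFn_smul a f,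
        AEEqFun.coeFn_smul a (f * g), AEEqFun.coeFn_mul f g] with ω h1 h2 h3 h4
      simp only [h1, h2, h3, h4, Pi.mul_apply, Pi.smul_apply, smul_mul_assoc])
    (fun a f g => by
      refine AEEqFun.ext ?_
      filter_upwards [AEEqFun.coeFn_mul f (a • g), AEEqFun.coeFn_smul a g,
        AEEqFun.coeFn_smul a (f * g), AEEqFun.coeFn_mul f g] with ω h1 h2 h3 h4
      simp only [h1, h2, h3, h4, Pi.mul_apply, Pi.smul_apply, mul_smul_comm])

end Ring

section Bundle

variable {Ω : Type u} [MeasurableSpace Ω] {μ : Measure Ω} {H : Ω → Type v}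
  [∀ ω, NormedAddCommGroup (H ω)] [∀ ω, InnerProductSpace ℂ (H ω)]
  [∀ ω, CompleteSpace (H ω)]

/-- `s = ∑ i, χ_{A i} c i` on the common domain of the `c i ∈ L`. The values of `s` off that
co-null set are irrelevant. -/
def MeasurableBundle.IsStep (E : MeasurableBundle μ H) (s : ∀ ω, H ω) : Prop :=
  ∃ (ι : Type) (_ : Fintype ι) (c : ι → PartialSection μ H) (A : ι → Set Ω),
    (∀ i, c i ∈ E.L) ∧ (∀ i, MeasurableSet (A i)) ∧
    ∀ ω, (∀ i, ω ∈ (c i).dom) →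
      s ω = ∑ i, (open Classical in if ω ∈ A i then (c i).ext ω else 0)

/-- Measurable sections: almost everywhere limits of sequences of step-sections. -/
def MeasurableBundle.IsMeasurableSection (E : MeasurableBundle μ H) (x : ∀ ω, H ω) : Prop :=
  ∃ s : ℕ → ∀ ω, H ω, (∀ n, E.IsStep (s n)) ∧
    ∀ᵐ ω ∂μ, Tendsto (fun n => ‖s n ω - x ω‖) atTop (𝓝 0)

theorem MeasurableBundle.IsStep.zero (E : MeasurableBundle μ H) :
    E.IsStep (0 : ∀ ω, H ω) :=
  ⟨Empty, inferInstance, Empty.elim, Empty.elim, by simp, by simp, by simp⟩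

theorem MeasurableBundle.IsStep.add {E : MeasurableBundle μ H} {s t : ∀ ω, H ω}
    (hs : E.IsStep s) (ht : E.IsStep t) : E.IsStep (s + t) := by
  obtain ⟨ι, _, c, A, hc, hA, h⟩ := hs
  obtain ⟨κ, _, d, B, hd, hB, k⟩ := ht
  refine ⟨ι ⊕ κ, inferInstance, Sum.elim c d, Sum.elim A B, ?_, ?_, ?_⟩
  · rintro (i | i)
    exacts [hc i, hd i]
  · rintro (i | i)
    exacts [hA i, hB i]
  · intro ω hω
    rw [Pi.add_apply, h ω (fun i => hω (Sum.inl i)), k ω (fun i => hω (Sum.inr i)),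
      Fintype.sum_sum_type]
    rfl

theorem MeasurableBundle.IsStep.smul_indicator {E : MeasurableBundle μ H} {s : ∀ ω, H ω}
    (hs : E.IsStep s) (a : ℂ) {B : Set Ω} (hB : MeasurableSet B) :
    E.IsStep (fun ω => B.indicator (fun _ => a) ω • s ω) := by
  classical
  obtain ⟨ι, _, c, A, hc, hA, h⟩ := hs
  refine ⟨ι, inferInstance, fun i => PartialSection.lin a (c i) 0 (c i), fun i => A i ∩ B,
    fun i => E.lin_mem _ _ _ (hc i) _ (hc i), fun i => (hA i).inter hB, ?_⟩
  intro ω hω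
  have hω' : ∀ i, ω ∈ (c i).dom := fun i => (hω i).1
  have he : ∀ i, (PartialSection.lin a (c i) 0 (c i)).ext ω = a • (c i).ext ω := by
    intro i
    unfold PartialSection.ext
    rw [dif_pos (hω i), dif_pos (hω' i)]
    simp [PartialSection.lin]
  simp only [h ω hω', Finset.smul_sum, he]
  refine Finset.sum_congr rfl fun i _ => ?_
  by_cases h1 : ω ∈ A i <;> by_cases h2 : ω ∈ B <;> simp [h1, h2]

theorem MeasurableBundle.IsStep.sum {E : MeasurableBundle μ H} {κ : Type*} (F : Finset κ)
    {s : κ → ∀ ω, H ω} (hs : ∀ k, E.IsStep (s k)) : E.IsStep (∑ k ∈ F, s k) := by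
  classical
  induction F using Finset.induction_on with
  | empty => simpa using MeasurableBundle.IsStep.zero E
  | insert a F ha ih => rw [Finset.sum_insert ha]; exact (hs a).add ih

theorem MeasurableBundle.IsStep.simple_smul {E : MeasurableBundle μ H} {s : ∀ ω, H ω}
    (hs : E.IsStep s) (g : SimpleFunc Ω ℂ) : E.IsStep (fun ω => g ω • s ω) := by
  classical
  have : (fun ω => g ω • s ω) =
      ∑ y ∈ g.range, fun ω => (g ⁻¹' {y}).indicator (fun _ => y) ω • s ω := by
    funext ω
    rw [Finset.sum_apply, Finset.sum_eq_single (g ω)]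
    · simp
    · intro y _ hy
      rw [Set.indicator_of_notMem (by simpa using hy.symm), zero_smul]
    · intro h
      exact absurd (g.mem_range_self ω) h
  rw [this]
  exact MeasurableBundle.IsStep.sum _ fun y => hs.smul_indicator y (g.measurableSet_fiber y)

theorem MeasurableBundle.IsMeasurableSection.congr {E : MeasurableBundle μ H} {x y : ∀ ω, H ω}
    (hx : E.IsMeasurableSection x) (h : ∀ᵐ ω ∂μ, x ω = y ω) : E.IsMeasurableSection y := by
  obtain ⟨s, hs, hl⟩ := hx
  refine ⟨s, hs, ?_⟩
  filter_upwards [hl, h] with ω h1 h2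
  rwa [← h2]

theorem MeasurableBundle.IsMeasurableSection.zero (E : MeasurableBundle μ H) :
    E.IsMeasurableSection (0 : ∀ ω, H ω) :=
  ⟨fun _ => 0, fun _ => MeasurableBundle.IsStep.zero E, by simp⟩

theorem MeasurableBundle.IsMeasurableSection.add {E : MeasurableBundle μ H} {x y : ∀ ω, H ω}
    (hx : E.IsMeasurableSection x) (hy : E.IsMeasurableSection y) :
    E.IsMeasurableSection (x + y) := by
  obtain ⟨s, hs, hl⟩ := hx
  obtain ⟨t, ht, hm⟩ := hy
  refine ⟨fun n => s n + t n, fun n => (hs n).add (ht n), ?_⟩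
  filter_upwards [hl, hm] with ω h1 h2
  rw [← tendsto_iff_norm_sub_tendsto_zero] at *
  exact h1.add h2

theorem MeasurableBundle.IsMeasurableSection.fun_smul {E : MeasurableBundle μ H} {x : ∀ ω, H ω}
    (hx : E.IsMeasurableSection x) {f : Ω → ℂ} (hf : StronglyMeasurable f) :
    E.IsMeasurableSection (fun ω => f ω • x ω) := by
  obtain ⟨s, hs, hl⟩ := hx
  refine ⟨fun n ω => hf.approx n ω • s n ω, fun n => (hs n).simple_smul _, ?_⟩
  filter_upwards [hl] with ω h1
  rw [← tendsto_iff_norm_sub_tendsto_zero] at *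
  exact (hf.tendsto_approx ω).smul h1

/-- `M(Ω, H)`: the space of measurable sections. Modifying an almost everywhere defined section on
a null set does not change its class, so everywhere defined representatives are used. -/
def MeasurableBundle.M (E : MeasurableBundle μ H) : Submodule ℂ (∀ ω, H ω) where
  carrier := {x | E.IsMeasurableSection x}
  zero_mem' := MeasurableBundle.IsMeasurableSection.zero E
  add_mem' := fun hx hy => hx.add hy
  smul_mem' := fun a _ hx => hx.fun_smul (f := fun _ => a) stronglyMeasurable_const

theorem MeasurableBundle.ae_ext_lin (_ : MeasurableBundle μ H) {a b : ℂ}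
    (c d : PartialSection μ H) :
    ∀ᵐ ω ∂μ, (PartialSection.lin a c b d).ext ω = a • c.ext ω + b • d.ext ω := by
  filter_upwards [c.ae_dom, d.ae_dom] with ω h1 h2
  unfold PartialSection.ext
  rw [dif_pos h1, dif_pos h2, dif_pos (show ω ∈ (PartialSection.lin a c b d).dom from ⟨h1, h2⟩)]
  rfl

theorem MeasurableBundle.aemeasurable_norm_ext (E : MeasurableBundle μ H)
    {c : PartialSection μ H} (hc : c ∈ E.L) : AEMeasurable (fun ω => ‖c.ext ω‖) μ := by
  classical
  obtain ⟨t, ht, htm, htn⟩ :=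
    (exists_measurable_superset_of_null (mem_ae_iff.1 c.ae_dom) :
      ∃ t, (c.dom)ᶜ ⊆ t ∧ MeasurableSet t ∧ μ t = 0)
  have hsub : tᶜ ⊆ c.dom := by
    intro ω hω
    by_contra h
    exact hω (ht h)
  have hm : Measurable (fun ω : (tᶜ : Set Ω) => ‖c.val ⟨ω, hsub ω.2⟩‖) :=
    (E.measurable_norm c hc).comp (measurable_inclusion hsub)
  refine ⟨fun ω => if h : ω ∈ tᶜ then ‖c.val ⟨ω, hsub h⟩‖ else 0,
    Measurable.dite hm measurable_const htm.compl, ?_⟩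
  filter_upwards [measure_eq_zero_iff_ae_notMem.1 htn] with ω hω
  have h1 : ω ∈ tᶜ := hω
  rw [dif_pos h1]
  unfold PartialSection.ext
  rw [dif_pos (hsub h1)]

theorem MeasurableBundle.aemeasurable_inner_ext (E : MeasurableBundle μ H)
    {c d : PartialSection μ H} (hc : c ∈ E.L) (hd : d ∈ E.L) :
    AEMeasurable (fun ω => inner ℂ (c.ext ω) (d.ext ω)) μ := by
  have key : ∀ a : ℂ, AEMeasurable (fun ω => ‖c.ext ω + a • d.ext ω‖) μ := by
    intro a
    refine (E.aemeasurable_norm_ext (E.lin_mem 1 a c hc d hd)).congr ?_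
    filter_upwards [E.ae_ext_lin (a := 1) (b := a) c d] with ω h
    rw [h, one_smul]
  have h1 := key 1
  have h2 := key (-1)
  have h3 := key Complex.I
  have h4 := key (-Complex.I)
  simp only [one_smul, neg_smul, ← sub_eq_add_neg] at h1 h2 h3 h4
  simp_rw [inner_eq_sum_norm_sq_div_four]
  simp only [RCLike.I_to_complex]
  exact ((((Complex.measurable_ofReal.comp_aemeasurable h1).pow_const 2).sub
    ((Complex.measurable_ofReal.comp_aemeasurable h2).pow_const 2)).add
    ((((Complex.measurable_ofReal.comp_aemeasurable h4).pow_const 2).sub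
    ((Complex.measurable_ofReal.comp_aemeasurable h3).pow_const 2)).mul_const _)).div_const _

theorem MeasurableBundle.IsStep.aemeasurable_inner {E : MeasurableBundle μ H} {s t : ∀ ω, H ω}
    (hs : E.IsStep s) (ht : E.IsStep t) : AEMeasurable (fun ω => inner ℂ (s ω) (t ω)) μ := by
  classical
  obtain ⟨ι, _, c, A, hc, hA, h⟩ := hs
  obtain ⟨κ, _, d, B, hd, hB, k⟩ := ht
  have hm : AEMeasurable (fun ω => ∑ i, ∑ j,
      (A i ∩ B j).indicator (fun ω => inner ℂ ((c i).ext ω) ((d j).ext ω)) ω) μ := by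
    refine Finset.aemeasurable_fun_sum _ fun i _ => Finset.aemeasurable_fun_sum _ fun j _ => ?_
    exact (E.aemeasurable_inner_ext (hc i) (hd j)).indicator ((hA i).inter (hB j))
  refine hm.congr ?_
  filter_upwards [ae_all_iff.2 fun i => (c i).ae_dom, ae_all_iff.2 fun j => (d j).ae_dom]
    with ω h1 h2
  rw [h ω h1, k ω h2, sum_inner]
  refine Finset.sum_congr rfl fun i _ => ?_
  rw [inner_sum]
  refine Finset.sum_congr rfl fun j _ => ?_
  by_cases p : ω ∈ A i <;> by_cases q : ω ∈ B j <;> simp [p, q]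

theorem MeasurableBundle.aestronglyMeasurable_inner {E : MeasurableBundle μ H} {x y : ∀ ω, H ω}
    (hx : E.IsMeasurableSection x) (hy : E.IsMeasurableSection y) :
    AEStronglyMeasurable (fun ω => inner ℂ (x ω) (y ω)) μ := by
  obtain ⟨s, hs, hl⟩ := hx
  obtain ⟨t, ht, hm⟩ := hy
  refine aestronglyMeasurable_of_tendsto_ae atTop (f := fun n ω => inner ℂ (s n ω) (t n ω))
    (fun n => ((hs n).aemeasurable_inner (ht n)).aestronglyMeasurable) ?_
  filter_upwards [hl, hm] with ω h1 h2
  rw [← tendsto_iff_norm_sub_tendsto_zero] at *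
  exact h1.inner h2

theorem MeasurableBundle.aestronglyMeasurable_norm {E : MeasurableBundle μ H} {x : ∀ ω, H ω}
    (hx : E.IsMeasurableSection x) : AEStronglyMeasurable (fun ω => ‖x ω‖) μ := by
  have h := (E.aestronglyMeasurable_inner hx hx).norm
  have h2 := (Real.continuous_sqrt.measurable.comp_aemeasurable h.aemeasurable)
  refine (h2.congr (Eventually.of_forall fun ω => ?_)).aestronglyMeasurable
  simp only [Function.comp]
  rw [inner_self_eq_norm_sq_to_K, norm_pow]
  simp

/-- The sections that vanish almost everywhere. -/
def MeasurableBundle.nullSections (E : MeasurableBundle μ H) : Submodule ℂ E.M where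
  carrier := {x | ∀ᵐ ω ∂μ, x.1 ω = 0}
  zero_mem' := by
    change ∀ᵐ ω ∂μ, (0 : H ω) = 0
    simp
  add_mem' := by
    intro x y hx hy
    change ∀ᵐ ω ∂μ, x.1 ω + y.1 ω = 0
    have hx' : ∀ᵐ ω ∂μ, x.1 ω = 0 := hx
    have hy' : ∀ᵐ ω ∂μ, y.1 ω = 0 := hy
    filter_upwards [hx', hy'] with ω h1 h2
    rw [h1, h2, add_zero]
  smul_mem' := by
    intro a x hx
    change ∀ᵐ ω ∂μ, a • x.1 ω = 0
    have hx' : ∀ᵐ ω ∂μ, x.1 ω = 0 := hx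
    filter_upwards [hx'] with ω h1
    rw [h1, smul_zero]

/-- `L⁰(Ω, H)`: measurable sections modulo almost everywhere equality. -/
def MeasurableBundle.L0 (E : MeasurableBundle μ H) : Type (max u v) := E.M ⧸ E.nullSections

instance (E : MeasurableBundle μ H) : AddCommGroup E.L0 :=
  inferInstanceAs (AddCommGroup (E.M ⧸ E.nullSections))

instance (E : MeasurableBundle μ H) : Module ℂ E.L0 :=
  inferInstanceAs (Module ℂ (E.M ⧸ E.nullSections))

/-- The class of a measurable section. -/
def MeasurableBundle.cls (E : MeasurableBundle μ H) : E.M →ₗ[ℂ] E.L0 := E.nullSections.mkQ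

theorem MeasurableBundle.cls_surjective (E : MeasurableBundle μ H) :
    Function.Surjective E.cls := Submodule.mkQ_surjective _

theorem MeasurableBundle.cls_eq_iff (E : MeasurableBundle μ H) {x y : E.M} :
    E.cls x = E.cls y ↔ ∀ᵐ ω ∂μ, x.1 ω = y.1 ω := by
  have h : E.cls x = E.cls y ↔ x - y ∈ E.nullSections := Submodule.Quotient.eq _
  rw [h]
  change (∀ᵐ ω ∂μ, x.1 ω - y.1 ω = 0) ↔ _
  simp only [sub_eq_zero]

/-- Pointwise multiplication of sections by (a representative of) `f ∈ L⁰(Ω)`. -/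
def MeasurableBundle.mulM (E : MeasurableBundle μ H) (f : Ω →ₘ[μ] ℂ) : E.M →ₗ[ℂ] E.M where
  toFun x := ⟨fun ω => f ω • x.1 ω, x.2.fun_smul f.stronglyMeasurable⟩
  map_add' x y := Subtype.ext (funext fun ω => smul_add (f ω) (x.1 ω) (y.1 ω))
  map_smul' a x := Subtype.ext (funext fun ω => smul_comm (f ω) a (x.1 ω))

instance (E : MeasurableBundle μ H) : SMul (Ω →ₘ[μ] ℂ) E.L0 where
  smul f := Submodule.mapQ E.nullSections E.nullSections (E.mulM f) (by
    intro x hx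
    have hx' : ∀ᵐ ω ∂μ, x.1 ω = 0 := hx
    change ∀ᵐ ω ∂μ, f ω • x.1 ω = 0
    filter_upwards [hx'] with ω h
    rw [h, smul_zero])

theorem MeasurableBundle.smul_cls (E : MeasurableBundle μ H) (f : Ω →ₘ[μ] ℂ) (x : E.M) :
    f • E.cls x = E.cls (E.mulM f x) := rfl

/-- `L⁰(Ω, H)` is a module over the algebra `L⁰(Ω)`. -/
instance (E : MeasurableBundle μ H) : Module (Ω →ₘ[μ] ℂ) E.L0 where
  one_smul u := by
    obtain ⟨x, rfl⟩ := E.cls_surjective u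
    rw [E.smul_cls, E.cls_eq_iff]
    filter_upwards [AEEqFun.coeFn_one (α := Ω) (μ := μ) (β := ℂ)] with ω h
    change (1 : Ω →ₘ[μ] ℂ) ω • x.1 ω = x.1 ω
    rw [h, Pi.one_apply, one_smul]
  mul_smul f g u := by
    obtain ⟨x, rfl⟩ := E.cls_surjective u
    rw [E.smul_cls, E.smul_cls, E.smul_cls, E.cls_eq_iff]
    filter_upwards [AEEqFun.coeFn_mul f g] with ω h
    change (f * g) ω • x.1 ω = f ω • g ω • x.1 ω
    rw [h, Pi.mul_apply, mul_smul]
  smul_zero f := by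
    rw [← map_zero E.cls, E.smul_cls, map_zero]
  smul_add f u w := by
    obtain ⟨x, rfl⟩ := E.cls_surjective u
    obtain ⟨y, rfl⟩ := E.cls_surjective w
    rw [← map_add, E.smul_cls, E.smul_cls, E.smul_cls, map_add, map_add]
  add_smul f g u := by
    obtain ⟨x, rfl⟩ := E.cls_surjective u
    rw [E.smul_cls, E.smul_cls, E.smul_cls, ← map_add, E.cls_eq_iff]
    filter_upwards [AEEqFun.coeFn_add f g] with ω h
    change (f + g) ω • x.1 ω = f ω • x.1 ω + g ω • x.1 ω
    rw [h, Pi.add_apply, add_smul]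
  zero_smul u := by
    obtain ⟨x, rfl⟩ := E.cls_surjective u
    rw [E.smul_cls, ← map_zero E.cls, E.cls_eq_iff]
    filter_upwards [AEEqFun.coeFn_zero (α := Ω) (μ := μ) (β := ℂ)] with ω h
    change (0 : Ω →ₘ[μ] ℂ) ω • x.1 ω = 0
    rw [h, Pi.zero_apply, zero_smul]

/-- The `L⁰`-valued norm: `‖û‖` is the class of `ω ↦ ‖u ω‖`. -/
def MeasurableBundle.vnorm (E : MeasurableBundle μ H) (u : E.L0) : Ω →ₘ[μ] ℝ :=
  Quotient.liftOn' u
    (fun x : E.M => AEEqFun.mk (fun ω => ‖x.1 ω‖) (E.aestronglyMeasurable_norm x.2))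
    (by
      intro x y h
      have h' : E.cls x = E.cls y := Quotient.sound' h
      rw [E.cls_eq_iff] at h'
      refine AEEqFun.mk_eq_mk.2 ?_
      filter_upwards [h'] with ω hω
      rw [hω])

theorem MeasurableBundle.vnorm_cls (E : MeasurableBundle μ H) (x : E.M) :
    E.vnorm (E.cls x) = AEEqFun.mk (fun ω => ‖x.1 ω‖) (E.aestronglyMeasurable_norm x.2) := rfl

/-- The `L⁰`-valued inner product: `⟨û, ŵ⟩` is the class of `ω ↦ (u ω, w ω)`, linear in the first
variable. -/
def MeasurableBundle.vinner (E : MeasurableBundle μ H) (u w : E.L0) : Ω →ₘ[μ] ℂ :=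
  Quotient.liftOn₂' u w
    (fun x y : E.M => AEEqFun.mk (fun ω => inner ℂ (y.1 ω) (x.1 ω))
      (E.aestronglyMeasurable_inner y.2 x.2))
    (by
      intro x y x' y' h k
      have h' : E.cls x = E.cls x' := Quotient.sound' h
      have k' : E.cls y = E.cls y' := Quotient.sound' k
      rw [E.cls_eq_iff] at h' k'
      refine AEEqFun.mk_eq_mk.2 ?_
      filter_upwards [h', k'] with ω hω kω
      rw [hω, kω])

theorem MeasurableBundle.vinner_cls (E : MeasurableBundle μ H) (x y : E.M) :
    E.vinner (E.cls x) (E.cls y) = AEEqFun.mk (fun ω => inner ℂ (y.1 ω) (x.1 ω))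
      (E.aestronglyMeasurable_inner y.2 x.2) := rfl

/-- A set of elements of `L⁰(Ω, H)` whose norms are order bounded in `L⁰(Ω)`. -/
def MeasurableBundle.IsBoundedSet (E : MeasurableBundle μ H) (B : Set E.L0) : Prop :=
  BddAbove (E.vnorm '' B)

/-- An `L⁰`-linear operator is `L⁰`-bounded if it maps bounded sets to bounded sets. -/
def MeasurableBundle.IsL0Bounded (E : MeasurableBundle μ H)
    (T : E.L0 →ₗ[Ω →ₘ[μ] ℂ] E.L0) : Prop :=
  ∀ B : Set E.L0, E.IsBoundedSet B → E.IsBoundedSet (T '' B)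

/-- An `L⁰`-linear and `L⁰`-bounded operator with `sup {‖T u‖ : ‖u‖ ≤ 1} ≤ 1` in `L⁰(Ω)`,
that is, such that `1` is an upper bound of that set. -/
def MeasurableBundle.IsContraction (E : MeasurableBundle μ H)
    (T : E.L0 →ₗ[Ω →ₘ[μ] ℂ] E.L0) : Prop :=
  E.IsL0Bounded T ∧ (1 : Ω →ₘ[μ] ℝ) ∈ upperBounds {e | ∃ u, E.vnorm u ≤ 1 ∧ e = E.vnorm (T u)}

/-- An (orthogonal) projection of `L⁰(Ω, H)`: an `L⁰`-linear, `L⁰`-bounded, idempotent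
and self-adjoint operator. -/
def MeasurableBundle.IsProjection (E : MeasurableBundle μ H)
    (P : E.L0 →ₗ[Ω →ₘ[μ] ℂ] E.L0) : Prop :=
  E.IsL0Bounded P ∧ (∀ u, P (P u) = P u) ∧ ∀ u w, E.vinner (P u) w = E.vinner u (P w)

/-- The Cesàro averages `A_n(T, u) = (1/n) ∑_{k<n} T^k u`. -/
def MeasurableBundle.average (E : MeasurableBundle μ H)
    (T : E.L0 →ₗ[Ω →ₘ[μ] ℂ] E.L0) (n : ℕ) (u : E.L0) : E.L0 :=
  (1 / (n : ℂ)) • ∑ k ∈ Finset.range n, (T ^ k) u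

/-- `(bo)`-convergence of a net `x` to `y`: some decreasing net `e` in `L⁰(Ω)` with
infimum `0` eventually dominates `‖y - x a‖`. -/
def MeasurableBundle.BoTendsto (E : MeasurableBundle μ H) {ι : Type*} [Preorder ι]
    (x : ι → E.L0) (y : E.L0) : Prop :=
  ∃ (Γ : Type) (_ : Preorder Γ) (_ : IsDirectedOrder Γ) (_ : Nonempty Γ) (e : Γ → (Ω →ₘ[μ] ℝ)),
    Antitone e ∧ IsGLB (Set.range e) 0 ∧ ∀ γ, ∃ a, ∀ b, a ≤ b → E.vnorm (y - x b) ≤ e γ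

/-- A measurable bundle of (bounded) linear operators in the fibers. -/
def MeasurableBundle.IsOperatorBundle (E : MeasurableBundle μ H)
    (S : ∀ ω, H ω →L[ℂ] H ω) : Prop :=
  ∀ x : ∀ ω, H ω, E.IsMeasurableSection x → E.IsMeasurableSection (fun ω => S ω (x ω))

/-- The action of a measurable bundle of operators on measurable sections. -/
def MeasurableBundle.glueM (E : MeasurableBundle μ H) (S : ∀ ω, H ω →L[ℂ] H ω)
    (hS : E.IsOperatorBundle S) : E.M →ₗ[ℂ] E.M where
  toFun x := ⟨fun ω => S ω (x.1 ω), hS x.1 x.2⟩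
  map_add' x y := Subtype.ext (funext fun ω => map_add (S ω) (x.1 ω) (y.1 ω))
  map_smul' a x := Subtype.ext (funext fun ω => map_smul (S ω) a (x.1 ω))

/-- The same action on classes of sections. -/
def MeasurableBundle.glueFun (E : MeasurableBundle μ H) (S : ∀ ω, H ω →L[ℂ] H ω)
    (hS : E.IsOperatorBundle S) : E.L0 →ₗ[ℂ] E.L0 :=
  Submodule.mapQ E.nullSections E.nullSections (E.glueM S hS) (by
    intro x hx
    have hx' : ∀ᵐ ω ∂μ, x.1 ω = 0 := hx
    change ∀ᵐ ω ∂μ, S ω (x.1 ω) = 0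
    filter_upwards [hx'] with ω h
    rw [h, map_zero])

/-- The `L⁰`-linear operator `Ŝ` glued from a measurable bundle of operators:
`Ŝ û` is the class of `ω ↦ S ω (u ω)`. -/
def MeasurableBundle.glue (E : MeasurableBundle μ H) (S : ∀ ω, H ω →L[ℂ] H ω)
    (hS : E.IsOperatorBundle S) : E.L0 →ₗ[Ω →ₘ[μ] ℂ] E.L0 where
  toFun := E.glueFun S hS
  map_add' := map_add _
  map_smul' f u := by
    obtain ⟨x, rfl⟩ := E.cls_surjective u
    change E.cls (E.glueM S hS (E.mulM f x)) = E.cls (E.mulM f (E.glueM S hS x))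
    exact congrArg E.cls (Subtype.ext (funext fun ω => map_smul (S ω) (f ω) (x.1 ω)))

theorem MeasurableBundle.glue_cls (E : MeasurableBundle μ H) (S : ∀ ω, H ω →L[ℂ] H ω)
    (hS : E.IsOperatorBundle S) (x : E.M) :
    E.glue S hS (E.cls x) = E.cls ⟨fun ω => S ω (x.1 ω), hS x.1 x.2⟩ := rfl

end Bundle

section Lifting

variable {Ω : Type u} [MeasurableSpace Ω]

/-- `L^∞(Ω)`, as a subalgebra of `L⁰(Ω)`. -/
def LInf (μ : Measure Ω) : Subalgebra ℂ (Ω →ₘ[μ] ℂ) where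
  carrier := {f | ∃ C : ℝ, ∀ᵐ ω ∂μ, ‖f ω‖ ≤ C}
  mul_mem' := by
    rintro f g ⟨C, hC⟩ ⟨D, hD⟩
    refine ⟨C * D, ?_⟩
    filter_upwards [hC, hD, AEEqFun.coeFn_mul f g] with ω h1 h2 h3
    rw [h3, Pi.mul_apply, norm_mul]
    exact mul_le_mul h1 h2 (norm_nonneg _) ((norm_nonneg _).trans h1)
  add_mem' := by
    rintro f g ⟨C, hC⟩ ⟨D, hD⟩
    refine ⟨C + D, ?_⟩
    filter_upwards [hC, hD, AEEqFun.coeFn_add f g] with ω h1 h2 h3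
    rw [h3, Pi.add_apply]
    exact (norm_add_le _ _).trans (add_le_add h1 h2)
  algebraMap_mem' := by
    intro a
    refine ⟨‖a‖, ?_⟩
    rw [Algebra.algebraMap_eq_smul_one]
    filter_upwards [AEEqFun.coeFn_smul a (1 : Ω →ₘ[μ] ℂ),
      AEEqFun.coeFn_one (α := Ω) (μ := μ) (β := ℂ)] with ω h1 h2
    rw [h1, Pi.smul_apply, h2, Pi.one_apply, smul_eq_mul, mul_one]

/-- The algebra of bounded measurable functions on `Ω`. -/
def BoundedMeasurable (Ω : Type u) [MeasurableSpace Ω] : Subalgebra ℂ (Ω → ℂ) where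
  carrier := {f | Measurable f ∧ ∃ C : ℝ, ∀ ω, ‖f ω‖ ≤ C}
  mul_mem' := by
    rintro f g ⟨hf, C, hC⟩ ⟨hg, D, hD⟩
    refine ⟨hf.mul hg, C * D, fun ω => ?_⟩
    rw [Pi.mul_apply, norm_mul]
    exact mul_le_mul (hC ω) (hD ω) (norm_nonneg _) ((norm_nonneg _).trans (hC ω))
  add_mem' := by
    rintro f g ⟨hf, C, hC⟩ ⟨hg, D, hD⟩
    exact ⟨hf.add hg, C + D, fun ω => (norm_add_le _ _).trans (add_le_add (hC ω) (hD ω))⟩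
  algebraMap_mem' := fun a => ⟨measurable_const, ‖a‖, fun _ => le_rfl⟩

/-- A lifting of `L^∞(Ω)`: a positive unital algebra homomorphism that picks an everywhere
defined bounded measurable representative of each class. -/
structure Lifting (μ : Measure Ω) where
  toAlgHom : LInf μ →ₐ[ℂ] BoundedMeasurable Ω
  ae_eq : ∀ f : LInf μ, ∀ᵐ ω ∂μ, (toAlgHom f).1 ω = f.1 ω
  nonneg : ∀ f : LInf μ, (∀ᵐ ω ∂μ, 0 ≤ (f.1 ω).re ∧ (f.1 ω).im = 0) →
    ∀ ω, 0 ≤ ((toAlgHom f).1 ω).re ∧ ((toAlgHom f).1 ω).im = 0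

variable {μ : Measure Ω} {H : Ω → Type v}
  [∀ ω, NormedAddCommGroup (H ω)] [∀ ω, InnerProductSpace ℂ (H ω)]
  [∀ ω, CompleteSpace (H ω)]

theorem MeasurableBundle.ae_vnorm (E : MeasurableBundle μ H) (x : E.M) :
    ∀ᵐ ω ∂μ, E.vnorm (E.cls x) ω = ‖x.1 ω‖ := by
  rw [E.vnorm_cls]
  exact AEEqFun.coeFn_mk _ _

/-- `L^∞(Ω, H)`: the classes with essentially bounded norm; a module over `L^∞(Ω)`. -/
def MeasurableBundle.LInfSec (E : MeasurableBundle μ H) : Submodule (LInf μ) E.L0 where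
  carrier := {u | ∃ C : ℝ, ∀ᵐ ω ∂μ, E.vnorm u ω ≤ C}
  zero_mem' := by
    refine ⟨0, ?_⟩
    rw [← map_zero E.cls]
    filter_upwards [E.ae_vnorm 0] with ω h
    rw [h]
    change ‖(0 : H ω)‖ ≤ 0
    rw [norm_zero]
  add_mem' := by
    rintro u w ⟨C, hC⟩ ⟨D, hD⟩
    obtain ⟨x, rfl⟩ := E.cls_surjective u
    obtain ⟨y, rfl⟩ := E.cls_surjective w
    refine ⟨C + D, ?_⟩
    rw [← map_add]
    filter_upwards [E.ae_vnorm x, E.ae_vnorm y, E.ae_vnorm (x + y), hC, hD] with ω h1 h2 h3 h4 h5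
    rw [h3]
    rw [h1] at h4
    rw [h2] at h5
    exact (norm_add_le (x.1 ω) (y.1 ω)).trans (add_le_add h4 h5)
  smul_mem' := by
    rintro ⟨f, C, hC⟩ u ⟨D, hD⟩
    obtain ⟨x, rfl⟩ := E.cls_surjective u
    refine ⟨C * D, ?_⟩
    change ∀ᵐ ω ∂μ, E.vnorm (E.cls (E.mulM f x)) ω ≤ C * D
    filter_upwards [E.ae_vnorm x, E.ae_vnorm (E.mulM f x), hC, hD] with ω h1 h3 h4 h5
    rw [h3]
    rw [h1] at h5
    change ‖f ω • x.1 ω‖ ≤ C * D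
    rw [norm_smul]
    exact mul_le_mul h4 h5 (norm_nonneg _) ((norm_nonneg _).trans h4)

/-- `‖u‖`, as an element of (complex) `L^∞(Ω)`, for `u ∈ L^∞(Ω, H)`. -/
def MeasurableBundle.normInf (E : MeasurableBundle μ H) (u : E.LInfSec) : LInf μ :=
  ⟨AEEqFun.comp Complex.ofReal Complex.continuous_ofReal (E.vnorm u.1), by
    obtain ⟨u, C, hC⟩ := u
    refine ⟨C, ?_⟩
    obtain ⟨x, rfl⟩ := E.cls_surjective u
    filter_upwards [AEEqFun.coeFn_comp Complex.ofReal Complex.continuous_ofReal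
      (E.vnorm (E.cls x)), hC, E.ae_vnorm x] with ω h1 h2 h3
    rw [h1]
    simp only [Function.comp, Complex.norm_real]
    rw [Real.norm_of_nonneg (by rw [h3]; exact norm_nonneg _)]
    exact h2⟩

/-- A vector valued lifting associated with the lifting `p`: it picks an everywhere defined
measurable section in each class of `L^∞(Ω, H)`, whose norm is then bounded by `norm_eq`. -/
structure VectorLifting (E : MeasurableBundle μ H) (p : Lifting μ) where
  toFun : E.LInfSec → E.M
  cls_eq : ∀ u, E.cls (toFun u) = u.1
  norm_eq : ∀ u ω, ((‖(toFun u).1 ω‖ : ℝ) : ℂ) = (p.toAlgHom (E.normInf u)).1 ω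
  map_add : ∀ u w, toFun (u + w) = toFun u + toFun w
  map_smul : ∀ (f : LInf μ) (u : E.LInfSec) (ω : Ω),
    (toFun ⟨f.1 • u.1, E.LInfSec.smul_mem f u.2⟩).1 ω = (p.toAlgHom f).1 ω • (toFun u).1 ω
  dense : ∀ ω, Dense (Set.range fun u => (toFun u).1 ω)

end Lifting

end HilbertKaplansky

end

/-! The obstacle is that `T` acts on classes only: without a lifting it need not come from operators
on the fibers, so the mean ergodic theorem cannot be applied fiber by fiber. It does suffice to look
at one orbit at a time. Fix `u` and choose representatives of all `T ^ k u`. By `L⁰`-homogeneity,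
`‖T v‖ ≤ ‖v‖` holds almost everywhere for every class `v`. Applying this to countably many
combinations of the orbit and passing to limits shows that, off one null set, the shift `T ^ k u ↦ T
^ (k + 1) u` is contractive on the span of the values at `ω` (`orbit_shift`). It therefore extends
to a contraction of `H ω`, depending on `u`, and von Neumann's theorem gives convergence of the
averages at `ω` (`exists_tendsto_average`). The limit is measurable because measurable sections are
closed under almost everywhere limits (`of_tendsto`).

The class of the limit defines `P u`. Uniqueness of limits makes `P` linear over `L⁰`, and `P`
inherits the pointwise bound `‖P u‖ ≤ ‖u‖`. Telescoping gives `T P = P`, hence `P` is idempotent,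
and a contractive idempotent is self-adjoint (`isProjection_of_norm_rep_le`). Order convergence
follows from almost everywhere convergence by taking suprema of tails.

For (a), the averages of `S ω` converge in every fiber, and their limits represent `P`. For (b),
positivity of the lifting turns `‖T u‖ ≤ ‖u‖` into an inequality at every `ω`, which determines a
contraction of `H ω` with `l(u)(ω) ↦ l(T u)(ω)`. -/

namespace HilbertKaplansky

universe u v

/-! ### Hilbert space facts used in a single fiber -/

section Fiber

variable {V : Type*} [NormedAddCommGroup V] [InnerProductSpace ℂ V]

/-- **Mean ergodic theorem** with the limit written as a projection of the whole space. -/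
theorem tendsto_average_starProjection [CompleteSpace V] (S : V →L[ℂ] V) (hS : ‖S‖ ≤ 1) (x : V) :
    Tendsto (fun n : ℕ => (1 / (n : ℂ)) • ∑ k ∈ Finset.range n, (S ^ k) x) atTop
      (𝓝 ((S.eqLocus (1 : V →L[ℂ] V)).starProjection x)) := by
  have h := S.tendsto_birkhoffAverage_orthogonalProjection hS x
  refine h.congr fun n => ?_
  simp only [birkhoffAverage, birkhoffSum, one_div, id]
  congr 1
  refine Finset.sum_congr rfl fun k _ => ?_
  rw [FunLike.coe_pow_eq_iterate]

/-- If `‖f a‖ ≤ ‖e a‖` for all `a`, then some contraction maps each `e a` to `f a`. -/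
theorem exists_contraction_of_norm_le [CompleteSpace V] {A : Type*} [AddCommGroup A] [Module ℂ A]
    (f e : A →ₗ[ℂ] V) (h : ∀ a, ‖f a‖ ≤ ‖e a‖) :
    ∃ S : V →L[ℂ] V, ‖S‖ ≤ 1 ∧ ∀ a, S (e a) = f a := by
  set K := (LinearMap.range e).topologicalClosure
  have hmem : ∀ a, e a ∈ K := fun a => Submodule.le_topologicalClosure _ ⟨a, rfl⟩
  have : CompleteSpace K := (Submodule.isClosed_topologicalClosure _).completeSpace_coe
  set e' : A →ₗ[ℂ] K := e.codRestrict K hmem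
  have hd : DenseRange e' := by
    rw [DenseRange, Subtype.dense_iff]
    intro y hy
    have : ((↑) : K → V) '' Set.range e' = LinearMap.range e := by
      ext z
      constructor
      · rintro ⟨_, ⟨a, rfl⟩, rfl⟩
        exact ⟨a, rfl⟩
      · rintro ⟨a, rfl⟩
        exact ⟨_, ⟨a, rfl⟩, rfl⟩
    exact closure_mono this.ge hy
  have hn : ∀ a, ‖f a‖ ≤ 1 * ‖e' a‖ := fun a => by rw [one_mul]; exact h a
  -- The norm inequality makes `e a ↦ f a` well defined and bounded on the range of `e`; it extends
  -- to the closure `K` and is continued by zero on the orthogonal complement.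
  refine ⟨f.extendOfNorm e' ∘L K.orthogonalProjectionOnto, ?_, fun a => ?_⟩
  · refine (ContinuousLinearMap.opNorm_comp_le _ _).trans ?_
    exact mul_le_one₀ (LinearMap.opNorm_extendOfNorm_le hd zero_le_one hn) (norm_nonneg _)
      (Submodule.orthogonalProjectionOnto_norm_le K)
  · have h1 : K.orthogonalProjectionOnto (e a) = e' a :=
      Submodule.orthogonalProjectionOnto_mem_subspace_eq_self (e' a)
    rw [ContinuousLinearMap.comp_apply, h1, LinearMap.extendOfNorm_eq hd ⟨1, hn⟩]

/-- The Cesàro averages of a sequence converge if the shift is contractive on its span. -/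
theorem exists_tendsto_average_of_shift_contractive [CompleteSpace V] (x : ℕ → V)
    (h : ∀ (n : ℕ) (a : ℕ → ℂ),
      ‖∑ k ∈ Finset.range n, a k • x (k + 1)‖ ≤ ‖∑ k ∈ Finset.range n, a k • x k‖) :
    ∃ y, Tendsto (fun n : ℕ => (1 / (n : ℂ)) • ∑ k ∈ Finset.range n, x k) atTop (𝓝 y) := by
  obtain ⟨S, hS, hx⟩ := exists_contraction_of_norm_le
    (Finsupp.linearCombination ℂ fun k => x (k + 1)) (Finsupp.linearCombination ℂ x) (by
      intro a
      obtain ⟨n, hn⟩ := a.support.exists_nat_subset_range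
      rw [Finsupp.linearCombination_apply, Finsupp.linearCombination_apply,
        Finsupp.sum_of_support_subset _ hn _ (by simp),
        Finsupp.sum_of_support_subset _ hn _ (by simp)]
      exact h n a)
  have hx1 : ∀ k, S (x k) = x (k + 1) := fun k => by
    simpa using hx (Finsupp.single k 1)
  have hk : ∀ k, (S ^ k) (x 0) = x k := by
    intro k
    induction k with
    | zero => simp
    | succ k ih => rw [pow_succ', mul_apply_eq_comp, ih, hx1]
  refine ⟨_, (tendsto_average_starProjection S hS (x 0)).congr fun n => ?_⟩
  simp only [hk]

/-- A vector that is a closest point to `0` on each line in direction `y` is orthogonal to `y`. -/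
theorem inner_eq_zero_of_norm_le_norm_add_smul {x y : V} (h : ∀ t : ℂ, ‖x‖ ≤ ‖x + t • y‖) :
    inner ℂ y x = 0 := by
  by_cases hy : y = 0
  · simp [hy]
  have hy' : (0 : ℝ) < ‖y‖ ^ 2 := by positivity
  set c : ℂ := inner ℂ y x with hc
  -- This `t` minimizes `‖x + t • y‖`: it removes the component of `x` along `y`.
  have h1 := h (-(c / (‖y‖ : ℂ) ^ 2))
  have h2 : ‖x + (-(c / (‖y‖ : ℂ) ^ 2)) • y‖ ^ 2 = ‖x‖ ^ 2 - ‖c‖ ^ 2 / ‖y‖ ^ 2 := by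
    rw [@norm_add_sq ℂ, inner_smul_right, ← inner_conj_symm, ← hc, norm_smul]
    have : -(c / (‖y‖ : ℂ) ^ 2) * (starRingEnd ℂ) c = ((-(‖c‖ ^ 2 / ‖y‖ ^ 2) : ℝ) : ℂ) := by
      push_cast
      rw [← Complex.mul_conj']
      ring
    rw [this, RCLike.re_to_complex, Complex.ofReal_re, norm_neg, norm_div, norm_pow, Complex.norm_real, norm_norm]
    field_simp
    ring
  have h3 : ‖x‖ ^ 2 ≤ ‖x‖ ^ 2 - ‖c‖ ^ 2 / ‖y‖ ^ 2 := by
    rw [← h2]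
    gcongr
  have h4 : ‖c‖ ^ 2 / ‖y‖ ^ 2 ≤ 0 := by linarith
  have h5 : ‖c‖ ^ 2 ≤ 0 := by
    by_contra hcon
    exact absurd h4 (not_le.2 (div_pos (not_le.1 hcon) hy'))
  have h6 : ‖c‖ = 0 := by nlinarith [norm_nonneg c]
  exact norm_eq_zero.1 h6

end Fiber

/-! ### Closure of measurable sections under almost everywhere limits -/

section Limits

variable {Ω : Type u} [MeasurableSpace Ω] {μ : Measure Ω} {H : Ω → Type v}
  [∀ ω, NormedAddCommGroup (H ω)] [∀ ω, InnerProductSpace ℂ (H ω)]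
  [∀ ω, CompleteSpace (H ω)]

theorem MeasurableBundle.IsStep.isMeasurableSection {E : MeasurableBundle μ H} {s : ∀ ω, H ω}
    (hs : E.IsStep s) : E.IsMeasurableSection s :=
  ⟨fun _ => s, fun _ => hs, by simp⟩

/-- A measurable section is arbitrarily close to some step-section off a small set. -/
theorem MeasurableBundle.IsMeasurableSection.exists_step_near [IsFiniteMeasure μ]
    {E : MeasurableBundle μ H} {x : ∀ ω, H ω} (hx : E.IsMeasurableSection x) {ε : ℝ} (hε : 0 < ε)
    {δ : ENNReal} (hδ : 0 < δ) :
    ∃ s, E.IsStep s ∧ μ {ω | ε ≤ ‖s ω - x ω‖} ≤ δ := by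
  obtain ⟨s, hs, hl⟩ := hx
  have hx : E.IsMeasurableSection x := ⟨s, hs, hl⟩
  -- Since `μ` is finite, almost everywhere convergence implies convergence in measure.
  have hm : TendstoInMeasure μ (fun n ω => ‖s n ω - x ω‖) atTop (fun _ => (0 : ℝ)) :=
    tendstoInMeasure_of_tendsto_ae
      (fun n => E.aestronglyMeasurable_norm (E.M.sub_mem (hs n).isMeasurableSection hx)) hl
  rw [tendstoInMeasure_iff_norm] at hm
  obtain ⟨n, hn⟩ := ((hm ε hε).eventually (eventually_le_nhds hδ)).exists
  exact ⟨s n, hs n, by simpa using hn⟩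

/-- Almost everywhere limits of measurable sections are measurable. -/
theorem MeasurableBundle.IsMeasurableSection.of_tendsto [IsFiniteMeasure μ]
    {E : MeasurableBundle μ H} {x : ℕ → ∀ ω, H ω} {y : ∀ ω, H ω}
    (hx : ∀ n, E.IsMeasurableSection (x n))
    (h : ∀ᵐ ω ∂μ, Tendsto (fun n => x n ω) atTop (𝓝 (y ω))) : E.IsMeasurableSection y := by
  have hpos : ∀ n : ℕ, (0 : ENNReal) < (1 / 2) ^ n := fun n =>
    ENNReal.pow_pos (by norm_num) n
  -- Both the error and the measure of the exceptional set are at most `2⁻ⁿ`. The measures are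
  -- summable, so by Borel–Cantelli almost every `ω` lies in only finitely many exceptional sets.
  choose s hs hsm using fun n => (hx n).exists_step_near (ε := (1 / 2) ^ n) (by positivity) (hpos n)
  refine ⟨s, hs, ?_⟩
  have hsum : ∑' n, μ {ω | (1 / 2 : ℝ) ^ n ≤ ‖s n ω - x n ω‖} ≠ ⊤ := by
    refine ne_top_of_le_ne_top ?_ (ENNReal.tsum_le_tsum hsm)
    rw [ENNReal.tsum_geometric]
    simp
  filter_upwards [h, ae_eventually_notMem hsum] with ω h1 h2
  rw [← tendsto_iff_norm_sub_tendsto_zero]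
  have h3 : Tendsto (fun n => s n ω - x n ω) atTop (𝓝 0) := by
    refine squeeze_zero_norm' ?_
      (tendsto_pow_atTop_nhds_zero_of_lt_one (r := (1 / 2 : ℝ)) (by norm_num) (by norm_num))
    filter_upwards [h2] with n hn
    exact (not_le.1 hn).le
  simpa using h3.add h1

end Limits

end HilbertKaplansky

namespace HilbertKaplansky

universe u v

variable {Ω : Type u} [MeasurableSpace Ω] {μ : Measure Ω} {H : Ω → Type v}
  [∀ ω, NormedAddCommGroup (H ω)] [∀ ω, InnerProductSpace ℂ (H ω)]
  [∀ ω, CompleteSpace (H ω)]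

/-! ### Pointwise calculus with arbitrarily chosen representatives, valid almost everywhere -/

section Representatives

/-- A representative of a class of sections. -/
noncomputable def MeasurableBundle.repM (E : MeasurableBundle μ H) (u : E.L0) : E.M :=
  Function.surjInv E.cls_surjective u

/-- The values of a representative of a class of sections. -/
noncomputable def MeasurableBundle.rep (E : MeasurableBundle μ H) (u : E.L0) (ω : Ω) : H ω :=
  (E.repM u).1 ω

variable (E : MeasurableBundle μ H)

theorem MeasurableBundle.cls_repM (u : E.L0) : E.cls (E.repM u) = u :=
  Function.surjInv_eq E.cls_surjective u

theorem MeasurableBundle.rep_isMeasurableSection (u : E.L0) : E.IsMeasurableSection (E.rep u) :=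
  (E.repM u).2

theorem MeasurableBundle.rep_cls (x : E.M) : ∀ᵐ ω ∂μ, E.rep (E.cls x) ω = x.1 ω :=
  E.cls_eq_iff.1 (E.cls_repM (E.cls x))

theorem MeasurableBundle.ext_rep {u w : E.L0} (h : ∀ᵐ ω ∂μ, E.rep u ω = E.rep w ω) : u = w := by
  rw [← E.cls_repM u, ← E.cls_repM w]
  exact E.cls_eq_iff.2 h

theorem MeasurableBundle.rep_zero : ∀ᵐ ω ∂μ, E.rep 0 ω = 0 := by
  have h := E.rep_cls 0
  rw [map_zero] at h
  exact h

theorem MeasurableBundle.rep_add (u w : E.L0) :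
    ∀ᵐ ω ∂μ, E.rep (u + w) ω = E.rep u ω + E.rep w ω := by
  have h := E.rep_cls (E.repM u + E.repM w)
  rw [map_add, E.cls_repM, E.cls_repM] at h
  exact h

theorem MeasurableBundle.rep_sub (u w : E.L0) :
    ∀ᵐ ω ∂μ, E.rep (u - w) ω = E.rep u ω - E.rep w ω := by
  have h := E.rep_cls (E.repM u - E.repM w)
  rw [map_sub, E.cls_repM, E.cls_repM] at h
  exact h

theorem MeasurableBundle.rep_const_smul (a : ℂ) (u : E.L0) :
    ∀ᵐ ω ∂μ, E.rep (a • u) ω = a • E.rep u ω := by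
  have h := E.rep_cls (a • E.repM u)
  rw [map_smul, E.cls_repM] at h
  exact h

theorem MeasurableBundle.rep_smul (f : Ω →ₘ[μ] ℂ) (u : E.L0) :
    ∀ᵐ ω ∂μ, E.rep (f • u) ω = f ω • E.rep u ω := by
  have h := E.rep_cls (E.mulM f (E.repM u))
  rw [← E.smul_cls, E.cls_repM] at h
  exact h

theorem MeasurableBundle.rep_sum {κ : Type*} (F : Finset κ) (u : κ → E.L0) :
    ∀ᵐ ω ∂μ, E.rep (∑ k ∈ F, u k) ω = ∑ k ∈ F, E.rep (u k) ω := by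
  classical
  induction F using Finset.induction_on with
  | empty => simpa using E.rep_zero
  | insert a F ha ih =>
    rw [Finset.sum_insert ha]
    filter_upwards [ih, E.rep_add (u a) (∑ k ∈ F, u k)] with ω h1 h2
    rw [h2, h1, Finset.sum_insert ha]

theorem MeasurableBundle.vnorm_rep (u : E.L0) : ∀ᵐ ω ∂μ, E.vnorm u ω = ‖E.rep u ω‖ := by
  have h := E.ae_vnorm (E.repM u)
  rw [E.cls_repM] at h
  exact h

theorem MeasurableBundle.vinner_rep (u w : E.L0) :
    ∀ᵐ ω ∂μ, E.vinner u w ω = inner ℂ (E.rep w ω) (E.rep u ω) := by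
  have h := AEEqFun.coeFn_mk _ (E.aestronglyMeasurable_inner (E.repM w).2 (E.repM u).2)
  rw [← E.vinner_cls, E.cls_repM, E.cls_repM] at h
  exact h

theorem MeasurableBundle.vnorm_le_iff {u w : E.L0} :
    E.vnorm u ≤ E.vnorm w ↔ ∀ᵐ ω ∂μ, ‖E.rep u ω‖ ≤ ‖E.rep w ω‖ := by
  rw [← AEEqFun.coeFn_le]
  constructor
  · intro h
    filter_upwards [h, E.vnorm_rep u, E.vnorm_rep w] with ω h1 h2 h3
    rwa [← h2, ← h3]
  · intro h
    filter_upwards [h, E.vnorm_rep u, E.vnorm_rep w] with ω h1 h2 h3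
    rwa [h2, h3]

theorem MeasurableBundle.vnorm_le_one_iff {u : E.L0} :
    E.vnorm u ≤ 1 ↔ ∀ᵐ ω ∂μ, ‖E.rep u ω‖ ≤ 1 := by
  rw [← AEEqFun.coeFn_le]
  constructor
  · intro h
    filter_upwards [h, E.vnorm_rep u, AEEqFun.coeFn_one (α := Ω) (μ := μ) (β := ℝ)] with ω h1 h2 h3
    rwa [← h2, ← Pi.one_apply (M := fun _ => ℝ) ω, ← h3]
  · intro h
    filter_upwards [h, E.vnorm_rep u, AEEqFun.coeFn_one (α := Ω) (μ := μ) (β := ℝ)] with ω h1 h2 h3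
    rwa [h2, h3]

theorem MeasurableBundle.vnorm_sub_tendsto_iff {u : ℕ → E.L0} {w : E.L0} :
    (∀ᵐ ω ∂μ, Tendsto (fun n => E.vnorm (u n - w) ω) atTop (𝓝 0)) ↔
      ∀ᵐ ω ∂μ, Tendsto (fun n => E.rep (u n) ω) atTop (𝓝 (E.rep w ω)) := by
  have key : ∀ᵐ ω ∂μ, ∀ n, E.vnorm (u n - w) ω = ‖E.rep (u n) ω - E.rep w ω‖ := by
    rw [ae_all_iff]
    intro n
    filter_upwards [E.vnorm_rep (u n - w), E.rep_sub (u n) w] with ω h1 h2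
    rw [h1, h2]
  refine eventually_congr ?_
  filter_upwards [key] with ω h
  simp only [h]
  exact tendsto_iff_norm_sub_tendsto_zero.symm

/-- Lets `L⁰`-linear operators pull out complex scalars, as the Cesàro averages require. -/
instance : IsScalarTower ℂ (Ω →ₘ[μ] ℂ) E.L0 where
  smul_assoc a f u := by
    refine E.ext_rep ?_
    filter_upwards [E.rep_smul (a • f) u, E.rep_const_smul a (f • u), E.rep_smul f u,
      AEEqFun.coeFn_smul a f] with ω h1 h2 h3 h4
    rw [h1, h2, h3, h4, Pi.smul_apply, smul_assoc]

end Representatives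

/-! ### Pointwise bounds for a contraction and convergence along an orbit -/

section Contraction

variable {E : MeasurableBundle μ H} {T : E.L0 →ₗ[Ω →ₘ[μ] ℂ] E.L0}

/-- Every class is a multiple of one in the unit ball, with the factor `ε + ‖u‖`. -/
theorem MeasurableBundle.exists_smul_vnorm_le_one (E : MeasurableBundle μ H) (u : E.L0) {ε : ℝ}
    (hε : 0 < ε) : ∃ (g : Ω →ₘ[μ] ℂ) (w : E.L0), E.vnorm w ≤ 1 ∧ u = g • w ∧
      ∀ᵐ ω ∂μ, g ω = ((ε + ‖E.rep u ω‖ : ℝ) : ℂ) := by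
  have hn := (E.aestronglyMeasurable_norm (E.rep_isMeasurableSection u)).aemeasurable
  have hg : AEStronglyMeasurable (fun ω => ((ε + ‖E.rep u ω‖ : ℝ) : ℂ)) μ :=
    (Complex.measurable_ofReal.comp_aemeasurable (hn.const_add ε)).aestronglyMeasurable
  have hg' : AEStronglyMeasurable (fun ω => ((ε + ‖E.rep u ω‖ : ℝ) : ℂ)⁻¹) μ :=
    (hg.aemeasurable.inv).aestronglyMeasurable
  have hpos : ∀ ω, 0 < ε + ‖E.rep u ω‖ := fun ω => by positivity
  refine ⟨AEEqFun.mk _ hg, AEEqFun.mk _ hg' • u, ?_, ?_, AEEqFun.coeFn_mk _ _⟩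
  · rw [E.vnorm_le_one_iff]
    filter_upwards [E.rep_smul (AEEqFun.mk _ hg') u, AEEqFun.coeFn_mk _ hg'] with ω h1 h2
    rw [h1, h2, norm_smul, norm_inv, Complex.norm_real, Real.norm_of_nonneg (hpos ω).le,
      inv_mul_le_one₀ (hpos ω)]
    linarith
  · refine E.ext_rep ?_
    filter_upwards [E.rep_smul (AEEqFun.mk _ hg) (AEEqFun.mk _ hg' • u),
      E.rep_smul (AEEqFun.mk _ hg') u, AEEqFun.coeFn_mk _ hg, AEEqFun.coeFn_mk _ hg']
      with ω h1 h2 h3 h4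
    rw [h1, h2, h3, h4, smul_smul, mul_inv_cancel₀, one_smul]
    exact_mod_cast (hpos ω).ne'

/-- The bound on the unit ball spreads by homogeneity: write `u = (ε + ‖u‖) • w` with `‖w‖ ≤ 1` and
pull the factor out of `T`. The term `ε` avoids division by zero, and letting it run through `1 / (n
+ 1)` costs only countably many null sets. -/
theorem MeasurableBundle.IsContraction.norm_rep_le (hT : E.IsContraction T) (u : E.L0) :
    ∀ᵐ ω ∂μ, ‖E.rep (T u) ω‖ ≤ ‖E.rep u ω‖ := by
  have key : ∀ n : ℕ, ∀ᵐ ω ∂μ, ‖E.rep (T u) ω‖ ≤ 1 / ((n : ℝ) + 1) + ‖E.rep u ω‖ := by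
    intro n
    have hε : (0 : ℝ) < 1 / ((n : ℝ) + 1) := by positivity
    obtain ⟨g, w, hw, hu, hg⟩ := E.exists_smul_vnorm_le_one u hε
    have h1 := E.vnorm_le_one_iff.1 (hT.2 ⟨w, hw, rfl⟩)
    have h2 : T u = g • T w := by rw [← map_smul, ← hu]
    rw [h2]
    filter_upwards [h1, E.rep_smul g (T w), hg] with ω h3 h4 h5
    rw [h4, h5, norm_smul, Complex.norm_real, Real.norm_of_nonneg (by positivity)]
    exact mul_le_of_le_one_right (by positivity) h3
  filter_upwards [ae_all_iff.2 key] with ω h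
  have hl : Tendsto (fun n : ℕ => 1 / ((n : ℝ) + 1) + ‖E.rep u ω‖) atTop (𝓝 (0 + ‖E.rep u ω‖)) :=
    tendsto_one_div_add_atTop_nhds_zero_nat.add_const _
  rw [zero_add] at hl
  exact ge_of_tendsto' hl h

theorem MeasurableBundle.isL0Bounded_of_norm_rep_le
    (hT : ∀ u, ∀ᵐ ω ∂μ, ‖E.rep (T u) ω‖ ≤ ‖E.rep u ω‖) : E.IsL0Bounded T := by
  rintro B ⟨b, hb⟩
  refine ⟨b, ?_⟩
  rintro _ ⟨_, ⟨u, hu, rfl⟩, rfl⟩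
  exact (E.vnorm_le_iff.2 (hT u)).trans (hb ⟨u, hu, rfl⟩)

theorem MeasurableBundle.rep_average (E : MeasurableBundle μ H) (T : E.L0 →ₗ[Ω →ₘ[μ] ℂ] E.L0)
    (n : ℕ) (u : E.L0) : ∀ᵐ ω ∂μ, E.rep (E.average T n u) ω =
      (1 / (n : ℂ)) • ∑ k ∈ Finset.range n, E.rep ((T ^ k) u) ω := by
  filter_upwards [E.rep_const_smul (1 / (n : ℂ)) (∑ k ∈ Finset.range n, (T ^ k) u),
    E.rep_sum (Finset.range n) fun k => (T ^ k) u] with ω h1 h2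
  rw [← h2, ← h1]
  rfl

/-- Off a null set, the shift is contractive on the span of the values of an orbit. -/
theorem MeasurableBundle.IsContraction.orbit_shift (hT : E.IsContraction T) (u : E.L0) :
    ∀ᵐ ω ∂μ, ∀ (n : ℕ) (a : ℕ → ℂ),
      ‖∑ k ∈ Finset.range n, a k • E.rep ((T ^ (k + 1)) u) ω‖ ≤
        ‖∑ k ∈ Finset.range n, a k • E.rep ((T ^ k) u) ω‖ := by
  have comb : ∀ (a : ℕ → ℂ) (w : ℕ → E.L0) (n : ℕ), ∀ᵐ ω ∂μ,
      E.rep (∑ k ∈ Finset.range n, a k • w k) ω =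
        ∑ k ∈ Finset.range n, a k • E.rep (w k) ω := by
    intro a w n
    filter_upwards [E.rep_sum (Finset.range n) fun k => a k • w k,
      ae_all_iff.2 fun k => E.rep_const_smul (a k) (w k)] with ω h1 h2
    simp only [h1, h2]
  rw [ae_all_iff]
  intro n
  -- The exceptional null set depends on the coefficients, so they are first restricted to a
  -- countable dense set; the inequality is closed in `a` and extends to all of them.
  have key : ∀ᵐ ω ∂μ, ∀ m : ℕ,
      ‖∑ k ∈ Finset.range n, TopologicalSpace.denseSeq (ℕ → ℂ) m k • E.rep ((T ^ (k + 1)) u) ω‖ ≤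
        ‖∑ k ∈ Finset.range n, TopologicalSpace.denseSeq (ℕ → ℂ) m k • E.rep ((T ^ k) u) ω‖ := by
    rw [ae_all_iff]
    intro m
    set a := TopologicalSpace.denseSeq (ℕ → ℂ) m
    filter_upwards [comb a (fun k => (T ^ k) u) n, comb a (fun k => (T ^ (k + 1)) u) n,
      hT.norm_rep_le (∑ k ∈ Finset.range n, a k • (T ^ k) u)] with ω h1 h2 h3
    rw [← h1, ← h2]
    refine le_of_eq_of_le ?_ h3
    rw [map_sum]
    simp only [LinearMap.map_smul_of_tower, pow_succ', Module.End.mul_apply]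
  filter_upwards [key] with ω h a
  refine (TopologicalSpace.denseRange_denseSeq (ℕ → ℂ)).induction_on a ?_ h
  refine isClosed_le ?_ ?_ <;> fun_prop

/-- For almost every `ω` the values of the orbit are the orbit of some contraction of `H ω`, to
which the mean ergodic theorem applies. No measurable dependence of that contraction on `ω` is
required, as only the limit has to be measurable. -/
theorem MeasurableBundle.IsContraction.exists_tendsto_average [IsFiniteMeasure μ]
    (hT : E.IsContraction T) (u : E.L0) : ∃ w : E.L0, ∀ᵐ ω ∂μ,
      Tendsto (fun n : ℕ => E.rep (E.average T n u) ω) atTop (𝓝 (E.rep w ω)) := by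
  classical
  -- The default value `0` is taken only on a null set.
  set y : ∀ ω, H ω := fun ω =>
    if h : ∃ y, Tendsto (fun n : ℕ => E.rep (E.average T n u) ω) atTop (𝓝 y) then h.choose else 0
  have hy : ∀ᵐ ω ∂μ, Tendsto (fun n : ℕ => E.rep (E.average T n u) ω) atTop (𝓝 (y ω)) := by
    filter_upwards [hT.orbit_shift u, ae_all_iff.2 fun n => E.rep_average T n u] with ω h1 h2
    have h : ∃ y, Tendsto (fun n : ℕ => E.rep (E.average T n u) ω) atTop (𝓝 y) := by
      simp only [h2]
      exact exists_tendsto_average_of_shift_contractive _ h1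
    simp only [y, dif_pos h]
    exact h.choose_spec
  refine ⟨E.cls ⟨y, .of_tendsto (fun n => E.rep_isMeasurableSection _) hy⟩, ?_⟩
  filter_upwards [hy, E.rep_cls ⟨y, .of_tendsto (fun n => E.rep_isMeasurableSection _) hy⟩]
    with ω h1 h2
  rwa [h2]

end Contraction

end HilbertKaplansky

namespace HilbertKaplansky

universe u v

variable {Ω : Type u} [MeasurableSpace Ω] {μ : Measure Ω} {H : Ω → Type v}
  [∀ ω, NormedAddCommGroup (H ω)] [∀ ω, InnerProductSpace ℂ (H ω)]
  [∀ ω, CompleteSpace (H ω)] {E : MeasurableBundle μ H} {T : E.L0 →ₗ[Ω →ₘ[μ] ℂ] E.L0}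

/-! ### The limit operator and its projection properties -/

section ErgodicProjection

theorem MeasurableBundle.average_add (n : ℕ) (u w : E.L0) :
    E.average T n (u + w) = E.average T n u + E.average T n w := by
  simp only [MeasurableBundle.average, map_add, Finset.sum_add_distrib, smul_add]

theorem MeasurableBundle.average_smul (n : ℕ) (f : Ω →ₘ[μ] ℂ) (u : E.L0) :
    E.average T n (f • u) = f • E.average T n u := by
  simp only [MeasurableBundle.average, map_smul, ← Finset.smul_sum]
  exact smul_comm _ _ _

theorem MeasurableBundle.eq_of_tendsto_rep {u : ℕ → E.L0} {w w' : E.L0}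
    (h : ∀ᵐ ω ∂μ, Tendsto (fun n => E.rep (u n) ω) atTop (𝓝 (E.rep w ω)))
    (h' : ∀ᵐ ω ∂μ, Tendsto (fun n => E.rep (u n) ω) atTop (𝓝 (E.rep w' ω))) : w = w' := by
  refine E.ext_rep ?_
  filter_upwards [h, h'] with ω h1 h2
  exact tendsto_nhds_unique h1 h2

/-- The limit of the Cesàro averages of a contraction, as an `L⁰`-linear operator. -/
noncomputable def MeasurableBundle.IsContraction.ergodicProjection [IsFiniteMeasure μ]
    (hT : E.IsContraction T) : E.L0 →ₗ[Ω →ₘ[μ] ℂ] E.L0 where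
  toFun u := (hT.exists_tendsto_average u).choose
  map_add' u w := by
    refine E.eq_of_tendsto_rep (hT.exists_tendsto_average (u + w)).choose_spec ?_
    filter_upwards [(hT.exists_tendsto_average u).choose_spec,
      (hT.exists_tendsto_average w).choose_spec,
      ae_all_iff.2 fun n => E.rep_add (E.average T n u) (E.average T n w),
      E.rep_add (hT.exists_tendsto_average u).choose (hT.exists_tendsto_average w).choose]
      with ω h1 h2 h3 h4
    simp only [E.average_add, h3, h4]
    exact h1.add h2
  map_smul' f u := by
    refine E.eq_of_tendsto_rep (hT.exists_tendsto_average (f • u)).choose_spec ?_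
    filter_upwards [(hT.exists_tendsto_average u).choose_spec,
      ae_all_iff.2 fun n => E.rep_smul f (E.average T n u),
      E.rep_smul f (hT.exists_tendsto_average u).choose] with ω h1 h3 h4
    simp only [E.average_smul, h3, h4, RingHom.id_apply]
    exact h1.const_smul (f ω)

theorem MeasurableBundle.IsContraction.tendsto_rep_average [IsFiniteMeasure μ]
    (hT : E.IsContraction T) (u : E.L0) : ∀ᵐ ω ∂μ,
    Tendsto (fun n : ℕ => E.rep (E.average T n u) ω) atTop
      (𝓝 (E.rep (hT.ergodicProjection u) ω)) :=
  (hT.exists_tendsto_average u).choose_spec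

theorem MeasurableBundle.IsContraction.norm_rep_pow_le (hT : E.IsContraction T) (k : ℕ)
    (u : E.L0) : ∀ᵐ ω ∂μ, ‖E.rep ((T ^ k) u) ω‖ ≤ ‖E.rep u ω‖ := by
  induction k with
  | zero => simp
  | succ k ih =>
    filter_upwards [ih, hT.norm_rep_le ((T ^ k) u)] with ω h1 h2
    rw [pow_succ', Module.End.mul_apply]
    exact h2.trans h1

theorem MeasurableBundle.IsContraction.norm_rep_average_le (hT : E.IsContraction T) (n : ℕ)
    (u : E.L0) : ∀ᵐ ω ∂μ, ‖E.rep (E.average T n u) ω‖ ≤ ‖E.rep u ω‖ := by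
  filter_upwards [E.rep_average T n u, ae_all_iff.2 fun k => hT.norm_rep_pow_le k u] with ω h1 h2
  rw [h1, norm_smul, norm_div, norm_one, Complex.norm_natCast]
  -- For `n = 0` the factor `1 / n` is `0`, and so is the average.
  rcases Nat.eq_zero_or_pos n with rfl | hn
  · simp
  have hn' : (0 : ℝ) < n := by exact_mod_cast hn
  rw [one_div, inv_mul_le_iff₀ hn']
  refine (norm_sum_le_of_le _ fun k _ => h2 k).trans ?_
  simp

theorem MeasurableBundle.IsContraction.norm_rep_ergodicProjection_le [IsFiniteMeasure μ]
    (hT : E.IsContraction T) (u : E.L0) :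
    ∀ᵐ ω ∂μ, ‖E.rep (hT.ergodicProjection u) ω‖ ≤ ‖E.rep u ω‖ := by
  filter_upwards [hT.tendsto_rep_average u, ae_all_iff.2 fun n => hT.norm_rep_average_le n u]
    with ω h1 h2
  exact le_of_tendsto' h1.norm h2

/-- The limit of the averages is fixed by the contraction. -/
theorem MeasurableBundle.IsContraction.map_ergodicProjection [IsFiniteMeasure μ]
    (hT : E.IsContraction T) (u : E.L0) :
    T (hT.ergodicProjection u) = hT.ergodicProjection u := by
  set w := hT.ergodicProjection u
  -- `T` preserves this pointwise convergence because `‖T (A_n u - w)‖ ≤ ‖A_n u - w‖` almost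
  -- everywhere.
  have h1 : ∀ᵐ ω ∂μ, Tendsto (fun n : ℕ => E.rep (T (E.average T n u)) ω) atTop
      (𝓝 (E.rep (T w) ω)) := by
    filter_upwards [hT.tendsto_rep_average u,
      ae_all_iff.2 fun n => hT.norm_rep_le (E.average T n u - w),
      ae_all_iff.2 fun n => E.rep_sub (E.average T n u) w,
      ae_all_iff.2 fun n => E.rep_sub (T (E.average T n u)) (T w)] with ω h1 h2 h3 h4
    rw [tendsto_iff_norm_sub_tendsto_zero] at h1 ⊢
    refine squeeze_zero (fun _ => norm_nonneg _) (fun n => ?_) h1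
    rw [← h4, ← h3, ← map_sub]
    exact h2 n
  refine E.eq_of_tendsto_rep h1 ?_
  -- The sum telescopes; the right side has norm at most `2 ‖u‖ / n`, so `T (A_n u)` and `A_n u`
  -- have the same limit.
  have h2 : ∀ n : ℕ, T (E.average T n u) - E.average T n u =
      (1 / (n : ℂ)) • ((T ^ n) u - u) := by
    intro n
    simp only [MeasurableBundle.average, LinearMap.map_smul_of_tower, map_sum, ← smul_sub,
      ← Finset.sum_sub_distrib]
    congr 1
    have := Finset.sum_range_sub (fun k => (T ^ k) u) n
    simp only [pow_succ', Module.End.mul_apply, pow_zero, Module.End.one_apply] at this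
    exact this
  filter_upwards [hT.tendsto_rep_average u, ae_all_iff.2 fun k => hT.norm_rep_pow_le k u,
    ae_all_iff.2 fun n : ℕ => E.rep_const_smul (1 / (n : ℂ)) ((T ^ n) u - u),
    ae_all_iff.2 fun n => E.rep_sub ((T ^ n) u) u,
    ae_all_iff.2 fun n => E.rep_sub (T (E.average T n u)) (E.average T n u)] with ω h3 h4 h5 h6 h7
  have h8 : Tendsto (fun n : ℕ => E.rep (T (E.average T n u)) ω - E.rep (E.average T n u) ω)
      atTop (𝓝 0) := by
    have hl : Tendsto (fun n : ℕ => (2 * ‖E.rep u ω‖) / (n : ℝ)) atTop (𝓝 0) :=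
      tendsto_const_div_atTop_nhds_zero_nat _
    refine squeeze_zero_norm (fun n => ?_) hl
    rw [← h7, h2, h5, h6, norm_smul, norm_div, norm_one, Complex.norm_natCast, div_mul_eq_mul_div,
      one_mul]
    gcongr
    refine (norm_sub_le _ _).trans ?_
    linarith [h4 n]
  simpa using h8.add h3

theorem MeasurableBundle.IsContraction.ergodicProjection_of_fixed [IsFiniteMeasure μ]
    (hT : E.IsContraction T) {u : E.L0} (hu : T u = u) :
    hT.ergodicProjection u = u := by
  refine E.eq_of_tendsto_rep (hT.tendsto_rep_average u) ?_
  have hk : ∀ k : ℕ, (T ^ k) u = u := by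
    intro k
    induction k with
    | zero => simp
    | succ k ih => rw [pow_succ, Module.End.mul_apply, hu, ih]
  filter_upwards with ω
  refine tendsto_const_nhds.congr' ?_
  filter_upwards [eventually_gt_atTop 0] with n hn
  have hn' : (n : ℂ) ≠ 0 := by exact_mod_cast hn.ne'
  have : E.average T n u = u := by
    simp only [MeasurableBundle.average, hk, Finset.sum_const, Finset.card_range]
    rw [← Nat.cast_smul_eq_nsmul ℂ, smul_smul, one_div, inv_mul_cancel₀ hn', one_smul]
  rw [this]

/-- A contractive idempotent operator is self-adjoint. -/
theorem MeasurableBundle.isProjection_of_norm_rep_le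
    (hle : ∀ u, ∀ᵐ ω ∂μ, ‖E.rep (T u) ω‖ ≤ ‖E.rep u ω‖) (hid : ∀ u, T (T u) = T u) :
    E.IsProjection T := by
  refine ⟨E.isL0Bounded_of_norm_rep_le hle, hid, ?_⟩
  -- Idempotence gives `T (T u + a • (w - T w)) = T u`, so contractivity makes `T u` the shortest
  -- vector on its line in direction `w - T w`, hence orthogonal to that direction.
  have key : ∀ u w : E.L0, ∀ᵐ ω ∂μ,
      inner ℂ (E.rep w ω - E.rep (T w) ω) (E.rep (T u) ω) = 0 := by
    intro u w
    have h : ∀ᵐ ω ∂μ, ∀ m : ℕ, ‖E.rep (T u) ω‖ ≤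
        ‖E.rep (T u) ω + TopologicalSpace.denseSeq ℂ m • (E.rep w ω - E.rep (T w) ω)‖ := by
      rw [ae_all_iff]
      intro m
      set a := TopologicalSpace.denseSeq ℂ m
      filter_upwards [hle (T u + a • (w - T w)), E.rep_add (T u) (a • (w - T w)),
        E.rep_const_smul a (w - T w), E.rep_sub w (T w)] with ω h1 h2 h3 h4
      rw [h2, h3, h4] at h1
      refine le_of_eq_of_le ?_ h1
      rw [map_add, LinearMap.map_smul_of_tower, map_sub, hid, hid, sub_self, smul_zero, add_zero]
    filter_upwards [h] with ω hω
    refine inner_eq_zero_of_norm_le_norm_add_smul fun t => ?_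
    refine (TopologicalSpace.denseRange_denseSeq ℂ).induction_on t ?_ hω
    refine isClosed_le ?_ ?_ <;> fun_prop
  -- Using orthogonality twice, `(w, T u) = (T w, T u) = (T w, u)`.
  intro u w
  refine AEEqFun.ext ?_
  filter_upwards [key u w, key w u, E.vinner_rep (T u) w, E.vinner_rep u (T w)] with ω h1 h2 h3 h4
  rw [h3, h4]
  rw [inner_sub_left, sub_eq_zero] at h1 h2
  rw [h1, ← inner_conj_symm, ← h2, inner_conj_symm]

theorem MeasurableBundle.IsContraction.isProjection_ergodicProjection [IsFiniteMeasure μ]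
    (hT : E.IsContraction T) :
    E.IsProjection hT.ergodicProjection :=
  E.isProjection_of_norm_rep_le hT.norm_rep_ergodicProjection_le fun u =>
    hT.ergodicProjection_of_fixed (hT.map_ergodicProjection u)

end ErgodicProjection

/-! ### From almost everywhere convergence to order convergence -/

section OrderConvergence

/-- For sequences, almost everywhere convergence implies `(bo)`-convergence. -/
theorem MeasurableBundle.boTendsto_of_ae_tendsto {x : ℕ → E.L0} {y : E.L0}
    (h : ∀ᵐ ω ∂μ, Tendsto (fun n => E.rep (x n) ω) atTop (𝓝 (E.rep y ω))) : E.BoTendsto x y := by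
  set f : ℕ → Ω → ℝ := fun n => E.vnorm (y - x n) with hf
  have hf0 : ∀ᵐ ω ∂μ, ∀ n, 0 ≤ f n ω := by
    rw [ae_all_iff]
    intro n
    filter_upwards [E.vnorm_rep (y - x n)] with ω h1
    rw [hf]
    simp only [h1]
    exact norm_nonneg _
  have hlim : ∀ᵐ ω ∂μ, Tendsto (fun n => f n ω) atTop (𝓝 0) := by
    filter_upwards [h, ae_all_iff.2 fun n => E.vnorm_rep (y - x n),
      ae_all_iff.2 fun n => E.rep_sub y (x n)] with ω h1 h2 h3
    simp only [hf, h2, h3]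
    simpa using ((tendsto_const_nhds (x := E.rep y ω)).sub h1).norm
  -- The dominating sequence is `sup_{m ≥ n} ‖y - x m‖`, decreasing in `n`.
  have hm : ∀ n, AEStronglyMeasurable (fun ω => ⨆ m, f (n + m) ω) μ := fun n =>
    (AEMeasurable.iSup fun m => (E.vnorm (y - x (n + m))).aemeasurable).aestronglyMeasurable
  -- A convergent sequence is bounded, so almost everywhere these real suprema are genuine and not
  -- the default value.
  have hbdd : ∀ᵐ ω ∂μ, ∀ n, BddAbove (Set.range fun m => f (n + m) ω) := by
    filter_upwards [hlim] with ω h1 n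
    refine h1.bddAbove_range.mono ?_
    rintro _ ⟨m, rfl⟩
    exact ⟨n + m, rfl⟩
  have hcoe : ∀ᵐ ω ∂μ, ∀ n, AEEqFun.mk _ (hm n) ω = ⨆ m, f (n + m) ω :=
    ae_all_iff.2 fun n => AEEqFun.coeFn_mk _ (hm n)
  refine ⟨ℕ, inferInstance, inferInstance, inferInstance, fun n => AEEqFun.mk _ (hm n),
    ?_, ⟨?_, ?_⟩, ?_⟩
  · intro n n' hn
    rw [← AEEqFun.coeFn_le]
    filter_upwards [hcoe, hbdd] with ω h1 h2
    rw [h1, h1]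
    refine ciSup_le fun m => ?_
    have := le_ciSup (h2 n) (n' - n + m)
    rwa [← add_assoc, Nat.add_sub_cancel' hn] at this
  · rintro _ ⟨n, rfl⟩
    rw [← AEEqFun.coeFn_le]
    filter_upwards [hcoe, hbdd, hf0, AEEqFun.coeFn_zero (α := Ω) (μ := μ) (β := ℝ)]
      with ω h1 h2 h3 h4
    rw [h4, h1, Pi.zero_apply]
    exact (h3 _).trans (le_ciSup (h2 n) 0)
  · intro g hg
    have hg' : ∀ᵐ ω ∂μ, ∀ n, g ω ≤ AEEqFun.mk _ (hm n) ω :=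
      ae_all_iff.2 fun n => AEEqFun.coeFn_le.2 (hg ⟨n, rfl⟩)
    rw [← AEEqFun.coeFn_le]
    filter_upwards [hcoe, hg', hlim, AEEqFun.coeFn_zero (α := Ω) (μ := μ) (β := ℝ)]
      with ω h1 h2 h3 h4
    rw [h4, Pi.zero_apply]
    refine le_of_forall_pos_le_add fun ε hε => ?_
    obtain ⟨N, hN⟩ := eventually_atTop.1 (h3.eventually (eventually_le_nhds hε))
    rw [zero_add]
    refine (h2 N).trans ?_
    rw [h1]
    exact ciSup_le fun m => hN _ (Nat.le_add_right N m)
  · intro n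
    refine ⟨n, fun b hb => ?_⟩
    rw [← AEEqFun.coeFn_le]
    filter_upwards [hcoe, hbdd] with ω h1 h2
    rw [h1]
    have := le_ciSup (h2 n) (b - n)
    rwa [Nat.add_sub_cancel' hb] at this

end OrderConvergence

/-! ### Operators glued from fiber contractions -/

section Gluing

theorem MeasurableBundle.rep_glue {S : ∀ ω, H ω →L[ℂ] H ω} (hS : E.IsOperatorBundle S)
    (u : E.L0) : ∀ᵐ ω ∂μ, E.rep (E.glue S hS u) ω = S ω (E.rep u ω) := by
  have h := E.rep_cls ⟨fun ω => S ω ((E.repM u).1 ω), hS _ (E.repM u).2⟩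
  rw [← E.glue_cls, E.cls_repM] at h
  exact h

theorem MeasurableBundle.rep_glue_pow {S : ∀ ω, H ω →L[ℂ] H ω} (hS : E.IsOperatorBundle S)
    (k : ℕ) (u : E.L0) : ∀ᵐ ω ∂μ, E.rep ((E.glue S hS ^ k) u) ω = (S ω ^ k) (E.rep u ω) := by
  induction k with
  | zero => simp
  | succ k ih =>
    filter_upwards [ih, E.rep_glue hS ((E.glue S hS ^ k) u)] with ω h1 h2
    rw [pow_succ', Module.End.mul_apply, h2, h1, pow_succ', mul_apply_eq_comp]

/-- The projections onto the fixed vectors of a measurable bundle of contractions form a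
measurable bundle of operators. -/
theorem MeasurableBundle.IsOperatorBundle.starProjection [IsFiniteMeasure μ]
    {S : ∀ ω, H ω →L[ℂ] H ω} (hS : E.IsOperatorBundle S) (hS1 : ∀ ω, ‖S ω‖ ≤ 1) :
    E.IsOperatorBundle fun ω => ((S ω).eqLocus (1 : H ω →L[ℂ] H ω)).starProjection := by
  intro x hx
  have hpow : ∀ k : ℕ, E.IsMeasurableSection fun ω => (S ω ^ k) (x ω) := by
    intro k
    induction k with
    | zero => simpa using hx
    | succ k ih =>
      have := hS _ ih
      simpa only [pow_succ', mul_apply_eq_comp] using this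
  refine .of_tendsto (x := fun n ω => (1 / (n : ℂ)) • ∑ k ∈ Finset.range n, (S ω ^ k) (x ω))
    (fun n => ?_) (Eventually.of_forall fun ω => tendsto_average_starProjection (S ω) (hS1 ω) (x ω))
  have h : (∑ k ∈ Finset.range n, fun ω => (S ω ^ k) (x ω)) ∈ E.M :=
    E.M.sum_mem fun k _ => hpow k
  have h' := E.M.smul_mem (1 / (n : ℂ)) h
  have he : ((1 / (n : ℂ)) • ∑ k ∈ Finset.range n, fun ω => (S ω ^ k) (x ω)) =
      fun ω => (1 / (n : ℂ)) • ∑ k ∈ Finset.range n, (S ω ^ k) (x ω) := by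
    funext ω
    simp only [Pi.smul_apply, Finset.sum_apply]
  rw [he] at h'
  exact h'

/-- Almost everywhere the averages of `T` are represented by the fiber averages of `S ω`, so the two
limits agree. -/
theorem MeasurableBundle.IsContraction.ergodicProjection_glue [IsFiniteMeasure μ]
    (hT : E.IsContraction T) {S : ∀ ω, H ω →L[ℂ] H ω} (hS : E.IsOperatorBundle S)
    (hS1 : ∀ ω, ‖S ω‖ ≤ 1) (hTS : T = E.glue S hS) :
    hT.ergodicProjection = E.glue _ (hS.starProjection hS1) := by
  subst hTS
  refine LinearMap.ext fun u => E.eq_of_tendsto_rep (hT.tendsto_rep_average u) ?_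
  filter_upwards [ae_all_iff.2 fun n => E.rep_average (E.glue S hS) n u,
    ae_all_iff.2 fun k => E.rep_glue_pow hS k u, E.rep_glue (hS.starProjection hS1) u]
    with ω h1 h2 h3
  rw [h3]
  simp only [h1, h2]
  exact tendsto_average_starProjection (S ω) (hS1 ω) _

end Gluing

/-! ### Fiber contractions obtained from a vector valued lifting -/

section VectorLifting

variable {p : Lifting μ}

theorem MeasurableBundle.IsContraction.map_mem_LInfSec (hT : E.IsContraction T) {u : E.L0}
    (hu : u ∈ E.LInfSec) : T u ∈ E.LInfSec := by
  obtain ⟨C, hC⟩ := hu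
  refine ⟨C, ?_⟩
  filter_upwards [hC, hT.norm_rep_le u, E.vnorm_rep u, E.vnorm_rep (T u)] with ω h1 h2 h3 h4
  rw [h4]
  rw [h3] at h1
  exact h2.trans h1

/-- The value of a vector valued lifting at a point. -/
def VectorLifting.evalAt (l : VectorLifting E p) (ω : Ω) : E.LInfSec →ₗ[ℂ] H ω where
  toFun u := (l.toFun u).1 ω
  map_add' u w := by
    rw [l.map_add]
    rfl
  map_smul' a u := by
    -- A complex scalar is a constant of `L^∞`, which the algebra homomorphism `p` preserves at
    -- every point.
    have h := l.map_smul (algebraMap ℂ (LInf μ) a) u ω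
    rw [p.toAlgHom.commutes] at h
    have hu : (⟨(algebraMap ℂ (LInf μ) a).1 • u.1, E.LInfSec.smul_mem _ u.2⟩ : E.LInfSec) =
        a • u := Subtype.ext (algebraMap_smul (Ω →ₘ[μ] ℂ) a u.1)
    rw [hu] at h
    exact h

/-- Positivity of `p`, applied to `‖w‖ - ‖u‖`, upgrades an almost everywhere inequality to one at
each `ω`. -/
theorem VectorLifting.norm_evalAt_mono (l : VectorLifting E p) {u w : E.LInfSec}
    (h : E.vnorm u.1 ≤ E.vnorm w.1) (ω : Ω) : ‖l.evalAt ω u‖ ≤ ‖l.evalAt ω w‖ := by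
  have h0 := (p.nonneg (E.normInf w - E.normInf u) (by
    have hc : ∀ v : E.LInfSec, ∀ᵐ ω ∂μ, (E.normInf v).1 ω = ((E.vnorm v.1 ω : ℝ) : ℂ) :=
      fun v => AEEqFun.coeFn_comp Complex.ofReal Complex.continuous_ofReal (E.vnorm v.1)
    filter_upwards [hc u, hc w, AEEqFun.coeFn_sub (E.normInf w).1 (E.normInf u).1,
      AEEqFun.coeFn_le.2 h] with ω h1 h2 h3 h4
    change 0 ≤ (((E.normInf w).1 - (E.normInf u).1 : Ω →ₘ[μ] ℂ) ω).re ∧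
      (((E.normInf w).1 - (E.normInf u).1 : Ω →ₘ[μ] ℂ) ω).im = 0
    rw [h3, Pi.sub_apply, h1, h2]
    simpa using h4) ω).1
  rw [map_sub] at h0
  have h1 : ((p.toAlgHom (E.normInf w) - p.toAlgHom (E.normInf u)).1 ω) =
      ((‖l.evalAt ω w‖ - ‖l.evalAt ω u‖ : ℝ) : ℂ) := by
    push_cast
    exact (congrArg₂ (· - ·) (l.norm_eq w ω) (l.norm_eq u ω)).symm
  rw [h1, Complex.ofReal_re] at h0
  linarith

/-- A contraction on a bundle with a vector valued lifting is glued from contractions. -/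
theorem MeasurableBundle.IsContraction.exists_eq_glue (hT : E.IsContraction T)
    (l : VectorLifting E p) : ∃ (S : ∀ ω, H ω →L[ℂ] H ω) (hS : E.IsOperatorBundle S),
      (∀ ω, ‖S ω‖ ≤ 1) ∧ T = E.glue S hS := by
  set T' : E.LInfSec →ₗ[ℂ] E.LInfSec :=
    { toFun := fun u => ⟨T u.1, hT.map_mem_LInfSec u.2⟩
      map_add' := fun u w => Subtype.ext (map_add T u.1 w.1)
      map_smul' := fun a u => Subtype.ext (T.map_smul_of_tower a u.1) }
  have hle : ∀ ω u, ‖(l.evalAt ω ∘ₗ T') u‖ ≤ ‖l.evalAt ω u‖ := fun ω u =>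
    l.norm_evalAt_mono (E.vnorm_le_iff.2 (hT.norm_rep_le u.1)) ω
  choose S hS1 hS using fun ω => exists_contraction_of_norm_le _ _ (hle ω)
  have hrep : ∀ u : E.LInfSec, ∀ᵐ ω ∂μ, l.evalAt ω u = E.rep u.1 ω := by
    intro u
    have h := E.rep_cls (l.toFun u)
    rw [l.cls_eq] at h
    filter_upwards [h] with ω hω using hω.symm
  have key : ∀ u : E.L0, ∀ᵐ ω ∂μ, S ω (E.rep u ω) = E.rep (T u) ω := by
    intro u
    -- The lifting acts on essentially bounded classes only, so `u` is divided by `1 + ‖u‖`; both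
    -- `T` and `S ω` commute with the factor.
    obtain ⟨g, w, hw, hu, -⟩ := E.exists_smul_vnorm_le_one u one_pos
    have hw' : w ∈ E.LInfSec := by
      refine ⟨1, ?_⟩
      filter_upwards [E.vnorm_le_one_iff.1 hw, E.vnorm_rep w] with ω h1 h2
      rwa [h2]
    have hTu : T u = g • T w := by rw [← map_smul, ← hu]
    rw [hTu]
    nth_rewrite 1 [hu]
    filter_upwards [hrep ⟨w, hw'⟩, hrep (T' ⟨w, hw'⟩), E.rep_smul g w, E.rep_smul g (T w)]
      with ω h1 h2 h3 h4
    rw [h3, h4, map_smul, ← h1, hS, LinearMap.comp_apply, h2]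
    rfl
  have hSb : E.IsOperatorBundle S := by
    intro x hx
    refine (E.rep_isMeasurableSection (T (E.cls ⟨x, hx⟩))).congr ?_
    filter_upwards [key (E.cls ⟨x, hx⟩), E.rep_cls ⟨x, hx⟩] with ω h1 h2
    rw [← h1, h2]
  refine ⟨S, hSb, hS1, LinearMap.ext fun u => E.ext_rep ?_⟩
  filter_upwards [key u, E.rep_glue hSb u] with ω h1 h2
  rw [h2, h1]

end VectorLifting

end HilbertKaplansky

open MeasureTheory Filter Topology HilbertKaplansky in
theorem theorem3p3 {Ω : Type*} [MeasurableSpace Ω] (μ : Measure Ω) [IsFiniteMeasure μ]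
    [μ.IsComplete] (H : Ω → Type*) [∀ ω, NormedAddCommGroup (H ω)]
    [∀ ω, InnerProductSpace ℂ (H ω)] [∀ ω, CompleteSpace (H ω)]
    (E : MeasurableBundle μ H) (T : E.L0 →ₗ[Ω →ₘ[μ] ℂ] E.L0) (hT : E.IsContraction T) :
    ∃ P : E.L0 →ₗ[Ω →ₘ[μ] ℂ] E.L0,
      E.IsProjection P ∧
      -- `A_n(T, u) → P u`, both in the sense of `(bo)`-convergence and
      -- in the sense that `‖A_n(T, u) - P u‖ → 0` almost everywhere
      (∀ u : E.L0, E.BoTendsto (fun n : ℕ => E.average T n u) (P u)) ∧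
      (∀ u : E.L0, ∀ᵐ ω ∂μ,
        Tendsto (fun n : ℕ => E.vnorm (E.average T n u - P u) ω) atTop (𝓝 0)) ∧
      -- whenever `T` is glued from contractions of the fibers, `P` is glued from
      -- the ergodic projections of these contractions
      (∀ (S : ∀ ω, H ω →L[ℂ] H ω) (hS : E.IsOperatorBundle S),
        (∀ ω, ‖S ω‖ ≤ 1) → T = E.glue S hS →
        ∃ (Q : ∀ ω, H ω →L[ℂ] H ω) (hQ : E.IsOperatorBundle Q),
          (∀ ω, IsStarProjection (Q ω)) ∧
          (∀ ω (x : H ω), Tendsto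
            (fun n : ℕ => (1 / (n : ℂ)) • ∑ k ∈ Finset.range n, (S ω ^ k) x) atTop (𝓝 (Q ω x))) ∧
          P = E.glue Q hQ) ∧
      -- and `T` is so glued if the bundle has a vector valued lifting
      (∀ p : Lifting μ, Nonempty (VectorLifting E p) →
        ∃ (S : ∀ ω, H ω →L[ℂ] H ω) (hS : E.IsOperatorBundle S),
          (∀ ω, ‖S ω‖ ≤ 1) ∧ T = E.glue S hS) :=
  ⟨hT.ergodicProjection, hT.isProjection_ergodicProjection,
    fun u => E.boTendsto_of_ae_tendsto (hT.tendsto_rep_average u),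
    fun u => E.vnorm_sub_tendsto_iff.2 (hT.tendsto_rep_average u),
    fun _ hS hS1 hTS => ⟨_, hS.starProjection hS1, fun _ => isStarProjection_starProjection,
      fun ω x => tendsto_average_starProjection _ (hS1 ω) x, hT.ergodicProjection_glue hS hS1 hTS⟩,
    fun _ ⟨l⟩ => hT.exists_eq_glue l⟩
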